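/- Let $c_0,c_1,c_2,\dots$ be independent identically distributed real random variables whose common law has a continuous density $r$ with respect to Lebesgue measure, with $\mathbf E\,c_k=0$ and $\mathbf E\,c_k^2=1$, and let $$f_n(x)=\sum_{k=0}^n\sqrt{\binom nk}\,c_k\,x^k .$$ A distribution density function of the real zeros of $f_n$ is a measurable function $p_n\ge 0$ on $\mathbb R$ such that $\mathbf E\,\#\{x\in[\alpha,\beta]: f_n(x)=0\}=\int_\alpha^\beta p_n(x)\,dx$ for all real $\alpha\le\beta$. Let $\varphi(s)=\int_{\mathbb R} r(t)e^{its}\,dt$. Assume that for some $a,q>0$ $$|\varphi(s)|\le\frac1{(1+as^2)^q}\qquad(s\in\mathbb R),$$ and that $\varphi$ is three times differentiable on $\mathbb R$ with $\sup_{s\in\mathbb R}|\varphi^{(j)}(s)|<\infty$ for $j=2,3$. Then every $f_n$ has a distribution density function of real zeros, and these densities $p_n$ $(n\ge0)$ can be chosen so that for every $\delta>0$: 1. $\displaystyle\lim_{n\to\infty}\frac{p_n(x)}{\sqrt n}=\frac1{\pi(1+x^2)}$ uniformly for all $x$ with $\delta\le|x|\le\delta^{-1}$; 2. there is $N$, depending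 on $\delta$ and on the law of the $c_k$, such that for all $n\ge N$ the function $p_n$ is continuous on $\{x:\delta\le|x|\le\delta^{-1}\}$, and for every $\varepsilon>0$ there is $C>0$ with $$\left|\frac{p_n(x)}{\sqrt n}-\frac1{\pi(1+x^2)}\right|\le C\,n^{-\frac1{12}+\varepsilon}\qquad\text{for all } n\ge N \text{ and all } x \text{ with } \delta\le|x|\le\delta^{-1}.$$ -/

import Mathlib

open MeasureTheory ProbabilityTheory Filter Set
open scoped ENNReal

/-- The polynomial `∑_{k=0}^n √(n choose k) c_k x^k`. -/
noncomputable def so2Poly (c : ℕ → ℝ) (n : ℕ) (x : ℝ) : ℝ :=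
  ∑ k ∈ Finset.range (n + 1), Real.sqrt (n.choose k : ℝ) * c k * x ^ k

/-- `p` is a distribution density function of the real zeros of the random function `F`: on every
interval `[a, b]` the expected number of (distinct) zeros is the integral of `p`. Both sides are
`[0, ∞]`-valued integrals, so no integrability has to be presupposed. -/
structure IsRealZeroDensity {Ω : Type*} [MeasurableSpace Ω] (P : Measure Ω)
    (F : Ω → ℝ → ℝ) (p : ℝ → ℝ) : Prop where
  measurable : Measurable p
  nonneg : ∀ x, 0 ≤ p x
  expected_card : ∀ a b : ℝ, a ≤ b →
    ∫⁻ ω, (({x : ℝ | x ∈ Icc a b ∧ F ω x = 0}.encard : ℕ∞) : ℝ≥0∞) ∂P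
      = ∫⁻ x in Icc a b, ENNReal.ofReal (p x)

/-- The set of reals `x` with `δ ≤ |x| ≤ δ⁻¹`. -/
def awayFromZero (δ : ℝ) : Set ℝ := {x : ℝ | δ ≤ |x| ∧ |x| ≤ δ⁻¹}

/-! The constant coefficient has density `r` and is independent of the others. Conditionally on
those, the zeros of `f_n` are the solutions of `c 0 = Q x` for a fixed polynomial `Q`, and the
one-dimensional area formula, averaged over `c 0`, yields the density `E |B| r(-A)`, where `A` and
`B` are the values at `x` of the nonconstant part of `f_n` and of its derivative
(`lintegral_encard_zeros_so2Poly`).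

The kernel identity `∫ (1 - cos (t y)) / t² dt = K |y|` and Parseval's formula turn this, for large
`n` and `x` away from `0`, into `(2πK)⁻¹ ∬ (Φ(s,0) - (Φ(s,t) + Φ(s,-t))/2) / t² ds dt`, with `Φ` the
characteristic function of `(f_n(x), f_n'(x))` (`lintegral_abs_mul_density_eq`). Removing from
`f_n'(x)` its regression on `f_n(x)` and normalizing variances is a linear change of variables that
brings out the factor `√n / (1 + x²)`. The normalized pair has coefficients `w k` and `w k * z k`,
where the `w k ^ 2` are binomial probabilities with parameter `x² / (1 + x²)` and `z k` is the
standardized index. If `Φ` is Gaussian the double integral is `2K`, hence the limit `1/π`.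

The rate comes from comparing `Φ` with the Gaussian. Put `ρ² = 1 + s² + t²` and `M = √n δ / 2`;
every `w k ^ 2` is at most `1/M` (`binomial_le`). The decay of `φ` makes `Φ` uniformly `O(ρ⁻¹²)`
(`exists_prod_norm_le`), and a Lyapunov estimate bounds the difference by `O(ρ³ M^(-1/2))`.
Interpolation gives `O(λ² ρ⁻²)` with `λ⁶ = 1/M`. Second differences are also `O(t²)`, so those of
the difference are at most `C min(t², λ²) / (1 + s²)` (`exists_secondDiff_sub_gauss_le`).
Integrating this against `t⁻²` costs `O(λ) = O(n^(-1/12))`. All bounds are uniform in `x`, so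
continuity follows by dominated convergence. -/

/-! ### Taylor bounds for a standardized characteristic function -/

/-- The part of the hypotheses on a characteristic function `φ` of a standardized law that concerns
its first derivatives `φ₁`, `φ₂`. -/
structure IsSmoothCharFun (φ φ₁ φ₂ : ℝ → ℂ) (c₂ c₃ : ℝ) : Prop where
  zero : φ 0 = 1
  norm_le : ∀ u, ‖φ u‖ ≤ 1
  hasDerivAt : ∀ u, HasDerivAt φ (φ₁ u) u
  hasDerivAt₁ : ∀ u, HasDerivAt φ₁ (φ₂ u) u
  deriv_zero : φ₁ 0 = 0
  norm_deriv₂_le : ∀ u, ‖φ₂ u‖ ≤ c₂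
  norm_deriv₂_add_one_le : ∀ u, ‖φ₂ u + 1‖ ≤ c₃ * |u|

/-- A function vanishing at `0` whose derivative is bounded by the nondecreasing function
`B |u|` satisfies `‖f u‖ ≤ B |u| * |u|`. -/
theorem norm_le_mul_abs_of_hasDerivAt {f f' : ℝ → ℂ} {B : ℝ → ℝ} (hf : ∀ u, HasDerivAt f (f' u) u)
    (h0 : f 0 = 0) (hB : ∀ u v, |u| ≤ |v| → ‖f' u‖ ≤ B |v|) (u : ℝ) :
    ‖f u‖ ≤ B |u| * |u| := by
  have := Convex.norm_image_sub_le_of_norm_hasDerivWithin_le (f := f) (f' := f')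
    (s := Icc (-|u|) |u|) (x := 0) (y := u) (C := B |u|)
    (fun x _ => (hf x).hasDerivWithinAt) (fun x hx => hB x u (abs_le.2 hx)) (convex_Icc _ _)
    ⟨by simp, by simp⟩ (abs_le.1 le_rfl)
  simpa [h0] using this

namespace IsSmoothCharFun

variable {φ φ₁ φ₂ : ℝ → ℂ} {c₂ c₃ : ℝ}

theorem const₂_nonneg (h : IsSmoothCharFun φ φ₁ φ₂ c₂ c₃) : 0 ≤ c₂ :=
  (norm_nonneg _).trans (h.norm_deriv₂_le 0)

theorem const₃_nonneg (h : IsSmoothCharFun φ φ₁ φ₂ c₂ c₃) : 0 ≤ c₃ := by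
  simpa using (norm_nonneg _).trans (h.norm_deriv₂_add_one_le 1)

protected theorem continuous (h : IsSmoothCharFun φ φ₁ φ₂ c₂ c₃) : Continuous φ :=
  continuous_iff_continuousAt.2 fun u => (h.hasDerivAt u).continuousAt

theorem norm_deriv_le (h : IsSmoothCharFun φ φ₁ φ₂ c₂ c₃) (u : ℝ) : ‖φ₁ u‖ ≤ c₂ * |u| :=
  norm_le_mul_abs_of_hasDerivAt (B := fun _ => c₂) h.hasDerivAt₁ h.deriv_zero
    (fun u _ _ => h.norm_deriv₂_le u) u

theorem norm_sub_quadratic_le (h : IsSmoothCharFun φ φ₁ φ₂ c₂ c₃) (u : ℝ) :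
    ‖φ u - (1 - (u : ℂ) ^ 2 / 2)‖ ≤ c₃ * |u| ^ 3 := by
  have h1 : ∀ u : ℝ, ‖φ₁ u + u‖ ≤ c₃ * |u| ^ 2 := fun u => by
    have := norm_le_mul_abs_of_hasDerivAt (f := fun u : ℝ => φ₁ u + u) (f' := fun u => φ₂ u + 1)
      (B := fun v => c₃ * v) (fun u => (h.hasDerivAt₁ u).add Complex.ofRealCLM.hasDerivAt)
      (by simp [h.deriv_zero])
      (fun u v huv => (h.norm_deriv₂_add_one_le u).trans
        (mul_le_mul_of_nonneg_left huv h.const₃_nonneg)) u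
    calc _ ≤ _ := this
      _ = _ := by ring
  have := norm_le_mul_abs_of_hasDerivAt (f := fun u : ℝ => φ u - (1 - (u : ℂ) ^ 2 / 2))
      (f' := fun u => φ₁ u + u) (B := fun v => c₃ * v ^ 2) (fun u => by
        have h2 : HasDerivAt (fun u : ℝ => (u : ℂ)) 1 u := Complex.ofRealCLM.hasDerivAt
        have := (h.hasDerivAt u).sub ((h2.pow 2).div_const 2 |>.const_sub 1)
        convert! this using 1
        simp)
      (by simp [h.zero])
      (fun u v huv => (h1 u).trans
        (mul_le_mul_of_nonneg_left (pow_le_pow_left₀ (abs_nonneg _) huv 2) h.const₃_nonneg)) u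
  calc _ ≤ _ := this
    _ = _ := by ring

/-- Both functions agree with `1 - u² / 2` to third order at `0`. For `|u| ≥ 1` the error of the
exponential is at most `u² / 2 ≤ |u|³`, so the cubic bound is global and can be summed over all
factors of a product. -/
theorem norm_sub_exp_le (h : IsSmoothCharFun φ φ₁ φ₂ c₂ c₃) (u : ℝ) :
    ‖φ u - (Real.exp (-u ^ 2 / 2) : ℂ)‖ ≤ (c₃ + 3) * |u| ^ 3 := by
  have h1 := h.norm_sub_quadratic_le u
  set y := u ^ 2 / 2 with hy
  have hy0 : 0 ≤ y := by positivity
  have hexp : |Real.exp (-u ^ 2 / 2) - (1 - u ^ 2 / 2)| ≤ 3 * |u| ^ 3 := by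
    have hneg : -u ^ 2 / 2 = -y := by rw [hy]; ring
    rw [hneg, ← hy]
    have hlow : 1 - y ≤ Real.exp (-y) := by linarith [Real.add_one_le_exp (-y)]
    rw [abs_of_nonneg (by linarith)]
    rcases le_total |u| 1 with hu | hu
    · have hup : Real.exp (-y) ≤ 1 - y + y ^ 2 := by
        have hy1 : y ≤ 1 := by
          rw [hy, ← sq_abs u]; nlinarith [abs_nonneg u]
        have := Real.abs_exp_sub_one_sub_id_le (x := -y) (by rwa [abs_neg, abs_of_nonneg hy0])
        have := (abs_le.1 this).2
        nlinarith
      have : y ^ 2 = |u| ^ 4 / 4 := by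
        rw [hy, ← sq_abs u]; ring
      have h4 : |u| ^ 4 ≤ |u| ^ 3 := pow_le_pow_of_le_one (abs_nonneg u) hu (by norm_num)
      have h3 : 0 ≤ |u| ^ 3 := by positivity
      linarith
    · have h3 : |u| ^ 2 ≤ |u| ^ 3 := pow_le_pow_right₀ hu (by norm_num)
      have : Real.exp (-y) ≤ 1 := Real.exp_le_one_iff.2 (by linarith)
      rw [sq_abs] at h3
      have : 0 ≤ u ^ 2 := sq_nonneg u
      linarith
  have h2 : ‖(1 - (u : ℂ) ^ 2 / 2) - (Real.exp (-u ^ 2 / 2) : ℂ)‖ ≤ 3 * |u| ^ 3 := by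
    rw [norm_sub_rev, ← Real.norm_eq_abs] at *
    convert! hexp using 1
    rw [← Complex.norm_real]
    push_cast
    rfl
  calc ‖φ u - (Real.exp (-u ^ 2 / 2) : ℂ)‖
      ≤ ‖φ u - (1 - (u : ℂ) ^ 2 / 2)‖ + ‖(1 - (u : ℂ) ^ 2 / 2) - (Real.exp (-u ^ 2 / 2) : ℂ)‖ :=
        norm_sub_le_norm_sub_add_norm_sub _ _ _
    _ ≤ c₃ * |u| ^ 3 + 3 * |u| ^ 3 := add_le_add h1 h2
    _ = _ := by ring

end IsSmoothCharFun

/-! ### Second differences of products of characteristic functions -/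

/-- The second difference of `Φ` in its second variable, centred at `0`. -/
noncomputable def secondDiff (Φ : ℝ → ℝ → ℂ) (s t : ℝ) : ℂ := Φ s 0 - (Φ s t + Φ s (-t)) / 2

/-- The characteristic function of the pair of linear forms with coefficients `a` and `b` in
independent variables with characteristic function `φ`. -/
noncomputable def linCharFun (φ : ℝ → ℂ) (I : Finset ℕ) (a b : ℕ → ℝ) (s t : ℝ) : ℂ :=
  ∏ k ∈ I, φ (a k * s + b k * t)

/-- The derivative `g₁ t - g₁ (-t)` of `g t + g (-t) - 2 * g 0` is at most `2 * C * |t|` by the mean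
value inequality. The resulting factor `t ^ 2` cancels the singularity of the kernel `1 / t ^ 2`. -/
theorem norm_secondDiff_le {g g₁ g₂ : ℝ → ℂ} {C : ℝ} (hg : ∀ t, HasDerivAt g (g₁ t) t)
    (hg₁ : ∀ t, HasDerivAt g₁ (g₂ t) t) (hC : ∀ t, ‖g₂ t‖ ≤ C) (t : ℝ) :
    ‖g 0 - (g t + g (-t)) / 2‖ ≤ C * t ^ 2 := by
  have hd : ∀ t, HasDerivAt (fun t => g t + g (-t) - 2 * g 0) (g₁ t - g₁ (-t)) t := fun t => by
    have h1 := (hg (-t)).scomp t (hasDerivAt_neg t)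
    have := ((hg t).add h1).sub_const (2 * g 0)
    convert! this using 1
    simp [sub_eq_add_neg]
  have h1 : ∀ u v : ℝ, |u| ≤ |v| → ‖g₁ u - g₁ (-u)‖ ≤ 2 * C * |v| := fun u v huv => by
    have hC0 : 0 ≤ C := (norm_nonneg _).trans (hC 0)
    have := Convex.norm_image_sub_le_of_norm_hasDerivWithin_le (f := g₁) (f' := g₂)
      (s := univ) (x := -u) (y := u) (C := C)
      (fun x _ => (hg₁ x).hasDerivWithinAt) (fun x _ => hC x) convex_univ trivial trivial
    have h2 : ‖u - -u‖ = 2 * |u| := by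
      rw [sub_neg_eq_add, ← two_mul, norm_mul, Real.norm_eq_abs, Real.norm_eq_abs]; norm_num
    rw [h2] at this
    nlinarith
  have h2 := norm_le_mul_abs_of_hasDerivAt (B := fun v => 2 * C * v) hd (by simp; ring) h1 t
  have h3 : g 0 - (g t + g (-t)) / 2 = -((g t + g (-t) - 2 * g 0) / 2) := by ring
  rw [h3, norm_neg, norm_div]
  have : ‖(2 : ℂ)‖ = 2 := by norm_num
  have h4 : 2 * C * |t| * |t| = C * t ^ 2 * 2 := by rw [← sq_abs t]; ring
  rw [this, div_le_iff₀ two_pos, ← h4]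
  exact h2

/-- Differentiating the product twice in `t` removes at most two factors, which is why the decay is
required after such deletions. Since `φ₁` vanishes at `0`, the mixed terms are controlled by `|b k|
* |u k t|`, and Cauchy-Schwarz bounds their sum independently of the number of factors. The growth
in `s ^ 2 + t ^ 2` costs one of the two powers of decay. -/
theorem norm_secondDiff_linCharFun_le {φ φ₁ φ₂ : ℝ → ℂ} {c₂ c₃ : ℝ}
    (h : IsSmoothCharFun φ φ₁ φ₂ c₂ c₃) (I : Finset ℕ) (a b : ℕ → ℝ) {A D : ℝ}
    (hab : ∑ k ∈ I, (a k ^ 2 + b k ^ 2) ≤ A)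
    (hD : ∀ R ⊆ I, R.card ≤ 2 → ∀ s t : ℝ,
      ∏ k ∈ I \ R, ‖φ (a k * s + b k * t)‖ ≤ D / (1 + s ^ 2 + t ^ 2) ^ 2) (s t : ℝ) :
    ‖secondDiff (linCharFun φ I a b) s t‖
      ≤ D * (c₂ * A + 2 * c₂ ^ 2 * A ^ 2) / (1 + s ^ 2) * t ^ 2 := by
  classical
  set u : ℕ → ℝ → ℝ := fun k t => a k * s + b k * t with hu
  have hA : 0 ≤ A := le_trans (Finset.sum_nonneg fun k _ => by positivity) hab
  have hD0 : 0 ≤ D := by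
    have := (Finset.prod_nonneg fun k _ => norm_nonneg _).trans
      (hD ∅ (by simp) (by simp) 0 0)
    simpa using this
  have hφ' : ∀ k t, HasDerivAt (fun t => φ (u k t)) (b k * φ₁ (u k t)) t := fun k t => by
    have h1 : HasDerivAt (u k) (b k) t := by
      simpa [hu] using ((hasDerivAt_id t).const_mul (b k)).const_add (a k * s)
    have := (h.hasDerivAt (u k t)).scomp t h1
    rwa [Complex.real_smul] at this
  have hφ'' : ∀ k t, HasDerivAt (fun t => (b k : ℂ) * φ₁ (u k t)) (b k ^ 2 * φ₂ (u k t)) t :=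
    fun k t => by
    have h1 : HasDerivAt (u k) (b k) t := by
      simpa [hu] using ((hasDerivAt_id t).const_mul (b k)).const_add (a k * s)
    have := ((h.hasDerivAt₁ (u k t)).scomp t h1).const_mul (b k : ℂ)
    convert! this using 1
    simp; ring
  refine norm_secondDiff_le (g := linCharFun φ I a b s)
    (g₁ := fun t => ∑ k ∈ I, (∏ j ∈ I.erase k, φ (u j t)) * (b k * φ₁ (u k t)))
    (g₂ := fun t => ∑ k ∈ I, ((∑ l ∈ I.erase k, (∏ j ∈ (I.erase k).erase l, φ (u j t)) *
      (b l * φ₁ (u l t))) * (b k * φ₁ (u k t)) +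
      (∏ j ∈ I.erase k, φ (u j t)) * (b k ^ 2 * φ₂ (u k t)))) ?_ ?_ ?_ t
  · intro t
    exact HasDerivAt.fun_finsetProd (u := I) fun k _ => hφ' k t
  · intro t
    refine HasDerivAt.fun_sum fun k _ => ?_
    refine HasDerivAt.fun_mul ?_ (hφ'' k t)
    simpa only [smul_eq_mul] using HasDerivAt.fun_finsetProd (u := I.erase k) fun l _ => hφ' l t
  · intro t
    set E := D / (1 + s ^ 2 + t ^ 2) ^ 2 with hE
    have hE0 : 0 ≤ E := by positivity
    have hP1 : ∀ k ∈ I, ‖∏ j ∈ I.erase k, φ (u j t)‖ ≤ E := fun k hk => by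
      rw [norm_prod, ← Finset.sdiff_singleton_eq_erase]
      exact hD {k} (by simpa using hk) (by simp) s t
    have hP2 : ∀ k ∈ I, ∀ l ∈ I.erase k, ‖∏ j ∈ (I.erase k).erase l, φ (u j t)‖ ≤ E :=
      fun k hk l hl => by
      have : (I.erase k).erase l = I \ {k, l} := by ext; simp; tauto
      rw [norm_prod, this]
      refine hD {k, l} ?_ Finset.card_le_two s t
      intro x hx
      simp only [Finset.mem_insert, Finset.mem_singleton] at hx
      rcases hx with rfl | rfl
      · exact hk
      · exact Finset.mem_of_mem_erase hl
    set S := ∑ k ∈ I, |b k| * |u k t| with hS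
    have hSsq : S ^ 2 ≤ 2 * A ^ 2 * (s ^ 2 + t ^ 2) := by
      have hcs := Finset.sum_mul_sq_le_sq_mul_sq I (fun k => |b k|) (fun k => |u k t|)
      simp only [sq_abs] at hcs
      have hb : ∑ k ∈ I, b k ^ 2 ≤ A :=
        (Finset.sum_le_sum fun k _ => by nlinarith [sq_nonneg (a k)]).trans hab
      have hu2 : ∑ k ∈ I, u k t ^ 2 ≤ 2 * A * (s ^ 2 + t ^ 2) := by
        calc ∑ k ∈ I, u k t ^ 2 ≤ ∑ k ∈ I, (a k ^ 2 + b k ^ 2) * (2 * (s ^ 2 + t ^ 2)) := by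
              refine Finset.sum_le_sum fun k _ => ?_
              simp only [hu]
              nlinarith [sq_nonneg (a k * t - b k * s), sq_nonneg (a k * s), sq_nonneg (b k * t),
                sq_nonneg (a k * t), sq_nonneg (b k * s)]
          _ ≤ A * (2 * (s ^ 2 + t ^ 2)) := by
              rw [← Finset.sum_mul]; gcongr
          _ = _ := by ring
      calc S ^ 2 ≤ _ := hcs
        _ ≤ A * (2 * A * (s ^ 2 + t ^ 2)) :=
          mul_le_mul hb hu2 (Finset.sum_nonneg fun k _ => sq_nonneg _) hA
        _ = _ := by ring
    have hc₂ := h.const₂_nonneg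
    have hb1 : ∀ k, ‖(b k : ℂ) * φ₁ (u k t)‖ ≤ c₂ * (|b k| * |u k t|) := fun k => by
      rw [norm_mul, Complex.norm_real, Real.norm_eq_abs]
      calc |b k| * ‖φ₁ (u k t)‖ ≤ |b k| * (c₂ * |u k t|) := by gcongr; exact h.norm_deriv_le _
        _ = _ := by ring
    have hinner : ∀ k ∈ I, ‖∑ l ∈ I.erase k, (∏ j ∈ (I.erase k).erase l, φ (u j t)) *
        (b l * φ₁ (u l t))‖ ≤ E * (c₂ * S) := fun k hk => by
      refine (norm_sum_le _ _).trans ?_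
      calc ∑ l ∈ I.erase k, ‖(∏ j ∈ (I.erase k).erase l, φ (u j t)) * (b l * φ₁ (u l t))‖
          ≤ ∑ l ∈ I.erase k, E * (c₂ * (|b l| * |u l t|)) := by
            refine Finset.sum_le_sum fun l hl => ?_
            rw [norm_mul]
            exact mul_le_mul (hP2 k hk l hl) (hb1 l) (norm_nonneg _) hE0
        _ ≤ ∑ l ∈ I, E * (c₂ * (|b l| * |u l t|)) :=
            Finset.sum_le_sum_of_subset_of_nonneg (Finset.erase_subset _ _)
              fun _ _ _ => by positivity
        _ = E * (c₂ * S) := by rw [hS, Finset.mul_sum, Finset.mul_sum]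
    have hS0 : 0 ≤ S := Finset.sum_nonneg fun k _ => by positivity
    calc ‖∑ k ∈ I, ((∑ l ∈ I.erase k, (∏ j ∈ (I.erase k).erase l, φ (u j t)) *
      (b l * φ₁ (u l t))) * (b k * φ₁ (u k t)) +
      (∏ j ∈ I.erase k, φ (u j t)) * (b k ^ 2 * φ₂ (u k t)))‖
        ≤ ∑ k ∈ I, (E * (c₂ * S) * (c₂ * (|b k| * |u k t|)) + E * ((a k ^ 2 + b k ^ 2) * c₂)) := by
          refine (norm_sum_le _ _).trans (Finset.sum_le_sum fun k hk => ?_)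
          refine (norm_add_le _ _).trans (add_le_add ?_ ?_)
          · rw [norm_mul]
            exact mul_le_mul (hinner k hk) (hb1 k) (norm_nonneg _) (by positivity)
          · rw [norm_mul, norm_mul, norm_pow, Complex.norm_real, Real.norm_eq_abs, sq_abs]
            refine mul_le_mul (hP1 k hk) ?_ (by positivity) hE0
            exact mul_le_mul (by nlinarith [sq_nonneg (a k)]) (h.norm_deriv₂_le _)
              (norm_nonneg _) (by positivity)
      _ = E * (c₂ ^ 2 * S ^ 2 + c₂ * ∑ k ∈ I, (a k ^ 2 + b k ^ 2)) := by
          rw [Finset.sum_add_distrib, ← Finset.mul_sum, ← Finset.mul_sum, ← Finset.mul_sum,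
            ← hS, ← Finset.sum_mul]
          ring
      _ ≤ E * (c₂ ^ 2 * (2 * A ^ 2 * (s ^ 2 + t ^ 2)) + c₂ * A) := by gcongr
      _ ≤ E * ((c₂ * A + 2 * c₂ ^ 2 * A ^ 2) * (1 + s ^ 2 + t ^ 2)) := by
          gcongr
          have h1 : 0 ≤ c₂ ^ 2 * A ^ 2 := by positivity
          have h2 : 0 ≤ c₂ * A * (s ^ 2 + t ^ 2) := by positivity
          nlinarith
      _ = D * (c₂ * A + 2 * c₂ ^ 2 * A ^ 2) / (1 + s ^ 2 + t ^ 2) := by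
          rw [hE]; field_simp
      _ ≤ D * (c₂ * A + 2 * c₂ ^ 2 * A ^ 2) / (1 + s ^ 2) := by
          refine div_le_div_of_nonneg_left (by positivity) (by positivity) ?_
          nlinarith [sq_nonneg t]

/-! ### Uniform decay of the product of characteristic functions -/

/-- The numbers `w k ^ 2` are a probability distribution with atoms of mass at most `1 / M`, for
which `z` is centred, with variance `1` and fourth moment at most `4`. -/
structure IsStdWeights (I : Finset ℕ) (w z : ℕ → ℝ) (M : ℝ) : Prop where
  sum_sq : ∑ k ∈ I, w k ^ 2 = 1
  sum_sq_mul : ∑ k ∈ I, w k ^ 2 * z k = 0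
  sum_sq_mul_sq : ∑ k ∈ I, w k ^ 2 * z k ^ 2 = 1
  sum_sq_mul_fourth_le : ∑ k ∈ I, w k ^ 2 * z k ^ 4 ≤ 4
  sq_le : ∀ k ∈ I, w k ^ 2 ≤ 1 / M

namespace IsStdWeights

variable {I : Finset ℕ} {w z : ℕ → ℝ} {M : ℝ}

theorem neg (h : IsStdWeights I w z M) : IsStdWeights I w (fun k => -z k) M where
  sum_sq := h.sum_sq
  sum_sq_mul := by simp [h.sum_sq_mul]
  sum_sq_mul_sq := by simp [h.sum_sq_mul_sq]
  sum_sq_mul_fourth_le := by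
    simpa [Even.neg_pow (by decide : Even 4)] using h.sum_sq_mul_fourth_le
  sq_le := h.sq_le

/-- A centred variable of variance 1 with bounded fourth moment cannot be concentrated on the
half-line below a small positive number. This is proved by averaging a quartic minorant of a
multiple of the indicator. -/
theorem le_sum_filter (h : IsStdWeights I w z M) :
    1 / 32 ≤ ∑ k ∈ I with 1 / 16 < z k, w k ^ 2 := by
  -- The mean of the quartic is at least `0 + 1/4 - 4/32 - 1/16 = 1/16`, which the factor `2` turns
  -- into mass `1/32`.
  have key : ∀ x : ℝ, x / 2 + x ^ 2 / 4 - x ^ 4 / 32 - 1 / 16 ≤ if 1 / 16 < x then 2 else 0 := by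
    intro x
    split_ifs with hx
    · nlinarith [sq_nonneg (x ^ 2 - 5), sq_nonneg (x - 2)]
    · push Not at hx
      rcases le_total 0 x with h0 | h0
      · have : x ^ 2 ≤ 1 / 16 * (1 / 16) := by nlinarith
        have : 0 ≤ x ^ 4 := by positivity
        linarith
      · have h1 : 0 ≤ 16 + 8 * x - x ^ 3 := by
          nlinarith [sq_nonneg (x + 2), sq_nonneg (x + 1),
            mul_nonneg (neg_nonneg.2 h0) (sq_nonneg (x + 2))]
        nlinarith [mul_nonneg (neg_nonneg.2 h0) h1]
  have h1 : ∑ k ∈ I, w k ^ 2 * (z k / 2 + z k ^ 2 / 4 - z k ^ 4 / 32 - 1 / 16)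
      ≤ ∑ k ∈ I, w k ^ 2 * (if 1 / 16 < z k then 2 else 0) :=
    Finset.sum_le_sum fun k _ => mul_le_mul_of_nonneg_left (key _) (sq_nonneg _)
  have h2 : ∑ k ∈ I, w k ^ 2 * (z k / 2 + z k ^ 2 / 4 - z k ^ 4 / 32 - 1 / 16)
      = (∑ k ∈ I, w k ^ 2 * z k) / 2 + (∑ k ∈ I, w k ^ 2 * z k ^ 2) / 4
        - (∑ k ∈ I, w k ^ 2 * z k ^ 4) / 32 - (∑ k ∈ I, w k ^ 2) / 16 := by
    simp only [Finset.sum_div, ← Finset.sum_add_distrib, ← Finset.sum_sub_distrib]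
    exact Finset.sum_congr rfl fun k _ => by ring
  have h3 : ∑ k ∈ I, w k ^ 2 * (if 1 / 16 < z k then (2 : ℝ) else 0)
      = (∑ k ∈ I with 1 / 16 < z k, w k ^ 2) * 2 := by
    rw [Finset.sum_filter, Finset.sum_mul]
    exact Finset.sum_congr rfl fun k _ => by split_ifs <;> simp
  rw [h2, h3, h.sum_sq, h.sum_sq_mul, h.sum_sq_mul_sq] at h1
  linarith [h.sum_sq_mul_fourth_le]

/-- If `s` and `t` do not have opposite signs, there is no cancellation in `s + t * z k` on the
indices with `z k > 1/16`, where its square is at least `(s ^ 2 + t ^ 2) / 256`. These indices carry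
enough mass for their factors alone to give the decay; the others are bounded by `1`. -/
theorem prod_norm_le_of_mul_nonneg (h : IsStdWeights I w z M) {φ : ℝ → ℂ} {a q : ℝ} (ha : 0 < a)
    (hq : 0 < q) (hφ : ∀ s : ℝ, ‖φ s‖ ≤ 1 / (1 + a * s ^ 2) ^ q) (hM : 192 ≤ M)
    {R : Finset ℕ} (hR : R.card ≤ 3) {s t : ℝ} (hst : 0 ≤ s * t) :
    ∏ k ∈ I \ R, ‖φ (w k * (s + t * z k))‖
      ≤ (1 + a * (s ^ 2 + t ^ 2) / 256 / M) ^ (-(q * M / 64)) := by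
  set X := 1 + a * (s ^ 2 + t ^ 2) / 256 / M with hX
  have hM0 : 0 < M := by linarith
  have hX1 : 1 ≤ X := by
    have : 0 ≤ a * (s ^ 2 + t ^ 2) / 256 / M := by positivity
    linarith
  set J := (I \ R).filter (fun k => 1 / 16 < z k) with hJ
  -- Three deleted atoms, each of mass at most `1 / M ≤ 1/192`, remove at most half of the mass
  -- `1/32`.
  have hmass : 1 / 64 ≤ ∑ k ∈ J, w k ^ 2 := by
    have h1 := h.le_sum_filter
    have h2 : ∑ k ∈ I with 1 / 16 < z k, w k ^ 2 ≤ ∑ k ∈ J, w k ^ 2 + ∑ k ∈ I ∩ R, w k ^ 2 := by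
      rw [← Finset.sum_union]
      · refine Finset.sum_le_sum_of_subset_of_nonneg ?_ fun _ _ _ => sq_nonneg _
        intro k hk
        simp only [hJ, Finset.mem_filter, Finset.mem_union, Finset.mem_sdiff,
          Finset.mem_inter] at hk ⊢
        tauto
      · refine Finset.disjoint_left.2 fun k hk hk' => ?_
        simp only [hJ, Finset.mem_filter, Finset.mem_sdiff, Finset.mem_inter] at hk hk'
        exact hk.1.2 hk'.2
    have h3 : ∑ k ∈ I ∩ R, w k ^ 2 ≤ 3 * (1 / M) := by
      calc ∑ k ∈ I ∩ R, w k ^ 2 ≤ ∑ k ∈ I ∩ R, 1 / M :=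
            Finset.sum_le_sum fun k hk => h.sq_le k (Finset.mem_inter.1 hk).1
        _ = (I ∩ R).card * (1 / M) := by simp
        _ ≤ 3 * (1 / M) := by
          gcongr
          exact_mod_cast (Finset.card_le_card Finset.inter_subset_right).trans hR
    have h4 : 3 * (1 / M) ≤ 1 / 64 := by
      rw [mul_one_div, div_le_div_iff₀ hM0 (by norm_num)]; linarith
    linarith
  have hfac : ∀ k ∈ J, ‖φ (w k * (s + t * z k))‖ ≤ X ^ (-(q * M) * w k ^ 2) := fun k hk => by
    simp only [hJ, Finset.mem_filter, Finset.mem_sdiff] at hk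
    have hz := hk.2
    have hw : w k ^ 2 * M ≤ 1 := by
      have := h.sq_le k hk.1.1
      rwa [le_div_iff₀ hM0] at this
    have h1 : (s ^ 2 + t ^ 2) / 256 ≤ (s + t * z k) ^ 2 := by
      have e1 : 0 ≤ s * t * z k := mul_nonneg hst (by linarith)
      have e2 : 1 / 256 ≤ z k ^ 2 := by nlinarith
      nlinarith [sq_nonneg s, mul_nonneg (sq_nonneg t) (sub_nonneg.2 e2)]
    -- Bernoulli's inequality with exponent `w k ^ 2 * M ≤ 1` replaces each factor by a power of the
    -- common base `X`, so that the exponents add up to a multiple of the mass.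
    have h2 : X ^ (w k ^ 2 * M) ≤ 1 + a * (w k * (s + t * z k)) ^ 2 := by
      have hb := rpow_one_add_le_one_add_mul_self (s := a * (s ^ 2 + t ^ 2) / 256 / M)
        (by have : 0 ≤ a * (s ^ 2 + t ^ 2) / 256 / M := by positivity
            linarith) (p := w k ^ 2 * M) (by positivity) hw
      refine hb.trans ?_
      have e3 : w k ^ 2 * M * (a * (s ^ 2 + t ^ 2) / 256 / M)
          = a * w k ^ 2 * ((s ^ 2 + t ^ 2) / 256) := by
        field_simp
      rw [e3, mul_pow, ← mul_assoc]
      gcongr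
    calc ‖φ (w k * (s + t * z k))‖ ≤ 1 / (1 + a * (w k * (s + t * z k)) ^ 2) ^ q := hφ _
      _ ≤ 1 / (X ^ (w k ^ 2 * M)) ^ q := by
          gcongr
      _ = X ^ (-(q * M) * w k ^ 2) := by
          rw [← Real.rpow_mul (by linarith), one_div, ← Real.rpow_neg (by linarith)]
          congr 1; ring
  have hle1 : ∀ u, ‖φ u‖ ≤ 1 := fun u => (hφ u).trans <| by
    rw [div_le_one (by positivity)]
    exact Real.one_le_rpow (by have : 0 ≤ a * u ^ 2 := by positivity
                               linarith) hq.le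
  calc ∏ k ∈ I \ R, ‖φ (w k * (s + t * z k))‖ ≤ ∏ k ∈ J, ‖φ (w k * (s + t * z k))‖ := by
        rw [← Finset.prod_filter_mul_prod_filter_not (I \ R) (fun k => 1 / 16 < z k)]
        exact mul_le_of_le_one_right (Finset.prod_nonneg fun _ _ => norm_nonneg _)
          (Finset.prod_le_one (fun _ _ => norm_nonneg _) fun _ _ => hle1 _)
    _ ≤ ∏ k ∈ J, X ^ (-(q * M) * w k ^ 2) :=
        Finset.prod_le_prod (fun _ _ => norm_nonneg _) hfac
    _ = X ^ (-(q * M) * ∑ k ∈ J, w k ^ 2) := by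
        rw [Finset.mul_sum, Real.rpow_sum_of_pos (by linarith)]
    _ ≤ X ^ (-(q * M / 64)) := by
        refine Real.rpow_le_rpow_of_exponent_le hX1 ?_
        have : 0 < q * M := by positivity
        nlinarith

/-- Opposite signs reduce to equal ones by replacing `z` with `-z` and `t` with `-t`. -/
theorem prod_norm_le (h : IsStdWeights I w z M) {φ : ℝ → ℂ} {a q : ℝ} (ha : 0 < a)
    (hq : 0 < q) (hφ : ∀ s : ℝ, ‖φ s‖ ≤ 1 / (1 + a * s ^ 2) ^ q) (hM : 192 ≤ M)
    {R : Finset ℕ} (hR : R.card ≤ 3) (s t : ℝ) :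
    ∏ k ∈ I \ R, ‖φ (w k * (s + t * z k))‖
      ≤ (1 + a * (s ^ 2 + t ^ 2) / 256 / M) ^ (-(q * M / 64)) := by
  rcases le_total 0 (s * t) with hst | hst
  · exact h.prod_norm_le_of_mul_nonneg ha hq hφ hM hR hst
  · have := h.neg.prod_norm_le_of_mul_nonneg ha hq hφ hM hR (s := s) (t := -t) (by linarith)
    simpa using this

end IsStdWeights

theorem exists_prod_norm_le {φ : ℝ → ℂ} {a q : ℝ} (ha : 0 < a)
    (hq : 0 < q) (hφ : ∀ s : ℝ, ‖φ s‖ ≤ 1 / (1 + a * s ^ 2) ^ q) :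
    ∃ M₀ D : ℝ, 1 ≤ M₀ ∧ 0 < D ∧ ∀ (I : Finset ℕ) (w z : ℕ → ℝ) (M : ℝ), M₀ ≤ M →
      IsStdWeights I w z M → ∀ R : Finset ℕ, R.card ≤ 3 → ∀ s t : ℝ,
        ∏ k ∈ I \ R, ‖φ (w k * (s + t * z k))‖ ≤ D / (1 + s ^ 2 + t ^ 2) ^ 6 := by
  -- The bound `192` pays for three deletions; `384 / q` makes the exponent `q * M₀ / 64` at least
  -- `6`.
  set M₀ : ℝ := max 192 (384 / q) with hM₀
  have h192 : 192 ≤ M₀ := le_max_left _ _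
  have hM₀pos : 0 < M₀ := by linarith
  have hqM : 6 ≤ q * M₀ / 64 := by
    have : 384 / q ≤ M₀ := le_max_right _ _
    rw [div_le_iff₀ hq] at this
    linarith
  set c := min 1 (a / 256 / M₀) with hc
  have hc0 : 0 < c := lt_min one_pos (by positivity)
  refine ⟨M₀, (c ^ 6)⁻¹, by linarith, by positivity, fun I w z M hM h R hR s t => ?_⟩
  have hMpos : 0 < M := by linarith
  refine (h.prod_norm_le ha hq hφ (h192.trans hM) hR s t).trans ?_
  set y := a * (s ^ 2 + t ^ 2) / 256 with hy
  have hy0 : 0 ≤ y := by positivity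
  have hyM : 0 ≤ y / M := by positivity
  have hyM₀ : 0 ≤ y / M₀ := by positivity
  -- Monotonicity of `(1 + y / M) ^ M` in `M`, by Bernoulli: the bound at `M₀` serves all larger
  -- `M`.
  have h1 : 1 + y / M₀ ≤ (1 + y / M) ^ (M / M₀) := by
    have := one_add_mul_self_le_rpow_one_add (s := y / M) (by linarith) (p := M / M₀)
      (by rwa [le_div_iff₀ hM₀pos, one_mul])
    convert this using 2
    field_simp
  have h2 : c * (1 + s ^ 2 + t ^ 2) ≤ 1 + y / M₀ := by
    have e1 : c ≤ 1 := min_le_left _ _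
    have e2 : c ≤ a / 256 / M₀ := min_le_right _ _
    have e3 : y / M₀ = a / 256 / M₀ * (s ^ 2 + t ^ 2) := by rw [hy]; ring
    rw [e3]
    nlinarith [mul_le_mul_of_nonneg_right e2 (by positivity : 0 ≤ s ^ 2 + t ^ 2)]
  have h3 : c ^ 6 * (1 + s ^ 2 + t ^ 2) ^ 6 ≤ (1 + y / M) ^ (q * M / 64) := by
    calc c ^ 6 * (1 + s ^ 2 + t ^ 2) ^ 6 = (c * (1 + s ^ 2 + t ^ 2)) ^ 6 := by ring
      _ ≤ (1 + y / M₀) ^ 6 := by gcongr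
      _ = (1 + y / M₀) ^ (6 : ℝ) := by norm_cast
      _ ≤ (1 + y / M₀) ^ (q * M₀ / 64) :=
          Real.rpow_le_rpow_of_exponent_le (by linarith) hqM
      _ ≤ ((1 + y / M) ^ (M / M₀)) ^ (q * M₀ / 64) :=
          Real.rpow_le_rpow (by linarith) h1 (by positivity)
      _ = (1 + y / M) ^ (q * M / 64) := by
          rw [← Real.rpow_mul (by linarith)]
          congr 1; field_simp
  rw [Real.rpow_neg (by linarith), div_eq_mul_inv (c ^ 6)⁻¹, ← mul_inv]
  gcongr

/-! ### Comparison with the Gaussian characteristic function -/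

theorem norm_prod_sub_prod_le_sum {ι : Type*} (I : Finset ι) (f g : ι → ℂ)
    (hf : ∀ i ∈ I, ‖f i‖ ≤ 1) (hg : ∀ i ∈ I, ‖g i‖ ≤ 1) :
    ‖∏ i ∈ I, f i - ∏ i ∈ I, g i‖ ≤ ∑ i ∈ I, ‖f i - g i‖ := by
  classical
  induction I using Finset.induction_on with
  | empty => simp
  | insert i I hi ih =>
    rw [Finset.prod_insert hi, Finset.prod_insert hi, Finset.sum_insert hi]
    have h1 : f i * ∏ j ∈ I, f j - g i * ∏ j ∈ I, g j
        = (f i - g i) * ∏ j ∈ I, f j + g i * (∏ j ∈ I, f j - ∏ j ∈ I, g j) := by ring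
    have h2 : ‖∏ j ∈ I, f j‖ ≤ 1 := by
      rw [norm_prod]
      exact Finset.prod_le_one (fun _ _ => norm_nonneg _)
        fun j hj => hf j (Finset.mem_insert_of_mem hj)
    have h3 := ih (fun j hj => hf j (Finset.mem_insert_of_mem hj))
      (fun j hj => hg j (Finset.mem_insert_of_mem hj))
    rw [h1]
    refine (norm_add_le _ _).trans (add_le_add ?_ ?_)
    · rw [norm_mul]
      exact mul_le_of_le_one_right (norm_nonneg _) h2
    · rw [norm_mul]
      exact (mul_le_of_le_one_left (norm_nonneg _) (hg i (Finset.mem_insert_self _ _))).trans h3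

/-- The characteristic function of the standard Gaussian law on the plane. -/
noncomputable def gaussCharFun (s t : ℝ) : ℂ := (Real.exp (-(s ^ 2 + t ^ 2) / 2) : ℝ)

theorem norm_gaussCharFun_le (s t : ℝ) :
    ‖gaussCharFun s t‖ ≤ 92160 / (1 + s ^ 2 + t ^ 2) ^ 6 := by
  rw [gaussCharFun, Complex.norm_real, Real.norm_eq_abs, Real.abs_exp,
    le_div_iff₀ (by positivity)]
  set R := s ^ 2 + t ^ 2 with hR
  have hR0 : 0 ≤ R := by positivity
  have h1 := Real.pow_div_factorial_le_exp ((1 + R) / 2) (by positivity) 6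
  have h2 : Real.exp ((1 + R) / 2) = Real.exp (1 / 2) * Real.exp (R / 2) := by
    rw [← Real.exp_add]; ring_nf
  have h3 : Real.exp (1 / 2) ≤ 2 := by
    have e := Real.exp_one_lt_d9
    have : Real.exp (1 / 2) * Real.exp (1 / 2) = Real.exp 1 := by rw [← Real.exp_add]; norm_num
    nlinarith [Real.exp_pos (1 / 2)]
  have h4 : Real.exp (-R / 2) * Real.exp (R / 2) = 1 := by
    rw [← Real.exp_add, ← Real.exp_zero]; congr 1; ring
  have h5 : (1 + s ^ 2 + t ^ 2) ^ 6 = 46080 * (((1 + R) / 2) ^ 6 / (Nat.factorial 6 : ℕ)) := by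
    rw [add_assoc, ← hR]; norm_num [Nat.factorial]; ring
  have h6 : (1 + s ^ 2 + t ^ 2) ^ 6 ≤ 92160 * Real.exp (R / 2) := by
    rw [h5]
    have := Real.exp_pos (R / 2)
    nlinarith
  calc Real.exp (-R / 2) * (1 + s ^ 2 + t ^ 2) ^ 6
      ≤ Real.exp (-R / 2) * (92160 * Real.exp (R / 2)) := by gcongr
    _ = 92160 * (Real.exp (-R / 2) * Real.exp (R / 2)) := by ring
    _ = 92160 := by rw [h4]; ring

theorem norm_secondDiff_gaussCharFun_le (s t : ℝ) :
    ‖secondDiff gaussCharFun s t‖ ≤ 1 / (1 + s ^ 2) * t ^ 2 := by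
  have h1 : secondDiff gaussCharFun s t
      = ((Real.exp (-s ^ 2 / 2) * (1 - Real.exp (-t ^ 2 / 2)) : ℝ) : ℂ) := by
    have e : ∀ t : ℝ, Real.exp (-(s ^ 2 + t ^ 2) / 2)
        = Real.exp (-s ^ 2 / 2) * Real.exp (-t ^ 2 / 2) := fun t => by
      rw [← Real.exp_add]; ring_nf
    simp only [secondDiff, gaussCharFun, e, neg_sq]
    push_cast
    simp
    ring
  have h2 : Real.exp (-t ^ 2 / 2) ≤ 1 := Real.exp_le_one_iff.2 (by nlinarith [sq_nonneg t])
  have h3 := Real.add_one_le_exp (-t ^ 2 / 2)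
  have h4 : Real.exp (-s ^ 2 / 2) ≤ 2 / (1 + s ^ 2) := by
    have e1 := Real.add_one_le_exp (s ^ 2 / 2)
    have e2 : Real.exp (-s ^ 2 / 2) * Real.exp (s ^ 2 / 2) = 1 := by
      rw [← Real.exp_add, ← Real.exp_zero]; congr 1; ring
    rw [le_div_iff₀ (by positivity)]
    have e3 := Real.exp_pos (-s ^ 2 / 2)
    nlinarith [sq_nonneg s]
  rw [h1, Complex.norm_real, Real.norm_of_nonneg
    (mul_nonneg (Real.exp_pos _).le (by linarith))]
  calc Real.exp (-s ^ 2 / 2) * (1 - Real.exp (-t ^ 2 / 2))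
      ≤ 2 / (1 + s ^ 2) * (t ^ 2 / 2) :=
        mul_le_mul h4 (by linarith) (by linarith) (by positivity)
    _ = _ := by ring

theorem secondDiff_sub (Φ Ψ : ℝ → ℝ → ℂ) (s t : ℝ) :
    secondDiff Φ s t - secondDiff Ψ s t
      = (Φ s 0 - Ψ s 0) - ((Φ s t - Ψ s t) + (Φ s (-t) - Ψ s (-t))) / 2 := by
  simp only [secondDiff]; ring

theorem norm_half_sum_le {x y z : ℂ} {C : ℝ} (hx : ‖x‖ ≤ C) (hy : ‖y‖ ≤ C) (hz : ‖z‖ ≤ C) :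
    ‖x - (y + z) / 2‖ ≤ 2 * C := by
  have h2 : ‖(2 : ℂ)‖ = 2 := by norm_num
  calc ‖x - (y + z) / 2‖ ≤ ‖x‖ + ‖(y + z) / 2‖ := norm_sub_le _ _
    _ ≤ ‖x‖ + (‖y‖ + ‖z‖) / 2 := by
        rw [norm_div, h2]; gcongr; exact norm_add_le _ _
    _ ≤ _ := by linarith

namespace IsStdWeights

variable {I : Finset ℕ} {w z : ℕ → ℝ} {M : ℝ}

theorem sum_linear_sq (h : IsStdWeights I w z M) (s t : ℝ) :
    ∑ k ∈ I, (w k * s + w k * z k * t) ^ 2 = s ^ 2 + t ^ 2 := by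
  calc ∑ k ∈ I, (w k * s + w k * z k * t) ^ 2
      = (∑ k ∈ I, w k ^ 2) * s ^ 2 + (∑ k ∈ I, w k ^ 2 * z k) * (2 * s * t)
        + (∑ k ∈ I, w k ^ 2 * z k ^ 2) * t ^ 2 := by
        simp only [Finset.sum_mul, ← Finset.sum_add_distrib]
        exact Finset.sum_congr rfl fun k _ => by ring
    _ = _ := by rw [h.sum_sq, h.sum_sq_mul, h.sum_sq_mul_sq]; ring

/-- One factor `|w k| ≤ √(1 / M)` is taken out of each cube. What remains is at most `ρ ^ 3` times
the mean of `(1 + z k ^ 2) ^ 2`, which is at most `1 + 2 + 4 = 7`. -/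
theorem sum_abs_cube_le (h : IsStdWeights I w z M) (hM : 0 < M) (s t : ℝ) :
    ∑ k ∈ I, |w k * s + w k * z k * t| ^ 3
      ≤ 7 * (Real.sqrt (1 + s ^ 2 + t ^ 2) ^ 3 * Real.sqrt (1 / M)) := by
  set ρ := Real.sqrt (1 + s ^ 2 + t ^ 2) with hρ
  have hρ2 : ρ ^ 2 = 1 + s ^ 2 + t ^ 2 := Real.sq_sqrt (by positivity)
  have hρ0 : 0 ≤ ρ := Real.sqrt_nonneg _
  have hk : ∀ k ∈ I, |w k * s + w k * z k * t| ^ 3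
      ≤ (w k ^ 2 * (1 + z k ^ 2) ^ 2) * (ρ ^ 3 * Real.sqrt (1 / M)) := fun k hk => by
    have e1 : |w k| ≤ Real.sqrt (1 / M) := Real.abs_le_sqrt (h.sq_le k hk)
    have e2 : |s + z k * t| ≤ ρ * Real.sqrt (1 + z k ^ 2) := by
      rw [hρ, ← Real.sqrt_mul (by positivity)]
      refine Real.abs_le_sqrt ?_
      nlinarith [sq_nonneg (s * z k - t), sq_nonneg (z k)]
    have e3 : Real.sqrt (1 + z k ^ 2) ^ 3 ≤ (1 + z k ^ 2) ^ 2 := by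
      have f1 : 1 ≤ Real.sqrt (1 + z k ^ 2) :=
        Real.one_le_sqrt.2 (by nlinarith [sq_nonneg (z k)])
      have f2 : Real.sqrt (1 + z k ^ 2) ^ 2 = 1 + z k ^ 2 := Real.sq_sqrt (by positivity)
      calc Real.sqrt (1 + z k ^ 2) ^ 3 ≤ Real.sqrt (1 + z k ^ 2) ^ 4 :=
            pow_le_pow_right₀ f1 (by norm_num)
        _ = (Real.sqrt (1 + z k ^ 2) ^ 2) ^ 2 := by ring
        _ = _ := by rw [f2]
    have e4 : w k * s + w k * z k * t = w k * (s + z k * t) := by ring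
    rw [e4, abs_mul, mul_pow]
    calc |w k| ^ 3 * |s + z k * t| ^ 3
        ≤ (|w k| ^ 2 * Real.sqrt (1 / M)) * (ρ * Real.sqrt (1 + z k ^ 2)) ^ 3 := by
          refine mul_le_mul ?_ (by gcongr) (by positivity) (by positivity)
          rw [pow_succ]; gcongr
      _ = (w k ^ 2 * Real.sqrt (1 / M)) * (ρ ^ 3 * Real.sqrt (1 + z k ^ 2) ^ 3) := by
          rw [sq_abs, mul_pow]
      _ ≤ (w k ^ 2 * Real.sqrt (1 / M)) * (ρ ^ 3 * (1 + z k ^ 2) ^ 2) := by gcongr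
      _ = _ := by ring
  refine (Finset.sum_le_sum hk).trans ?_
  rw [← Finset.sum_mul]
  refine mul_le_mul_of_nonneg_right ?_ (by positivity)
  calc ∑ k ∈ I, w k ^ 2 * (1 + z k ^ 2) ^ 2
      = ∑ k ∈ I, w k ^ 2 + 2 * ∑ k ∈ I, w k ^ 2 * z k ^ 2 + ∑ k ∈ I, w k ^ 2 * z k ^ 4 := by
        simp only [Finset.mul_sum, ← Finset.sum_add_distrib]
        exact Finset.sum_congr rfl fun k _ => by ring
    _ ≤ 7 := by rw [h.sum_sq, h.sum_sq_mul_sq]; linarith [h.sum_sq_mul_fourth_le]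

/-- Because the coefficient pairs are orthonormal, the Gaussian factors over the same indices. The
two products are then compared factor by factor, with the cubic Taylor error in each. -/
theorem norm_linCharFun_sub_gauss_le (h : IsStdWeights I w z M) (hM : 0 < M)
    {φ φ₁ φ₂ : ℝ → ℂ} {c₂ c₃ : ℝ} (hφ : IsSmoothCharFun φ φ₁ φ₂ c₂ c₃) (s t : ℝ) :
    ‖linCharFun φ I w (fun k => w k * z k) s t - gaussCharFun s t‖
      ≤ (c₃ + 3) * (7 * (Real.sqrt (1 + s ^ 2 + t ^ 2) ^ 3 * Real.sqrt (1 / M))) := by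
  have hG : gaussCharFun s t
      = ∏ k ∈ I, (Real.exp (-(w k * s + w k * z k * t) ^ 2 / 2) : ℂ) := by
    rw [gaussCharFun, ← h.sum_linear_sq s t, ← Complex.ofReal_prod, ← Real.exp_sum]
    congr 2
    rw [neg_div, Finset.sum_div, ← Finset.sum_neg_distrib]
    exact Finset.sum_congr rfl fun k _ => by ring
  rw [hG, linCharFun]
  have hc := hφ.const₃_nonneg
  calc _ ≤ ∑ k ∈ I, ‖φ (w k * s + w k * z k * t)
        - (Real.exp (-(w k * s + w k * z k * t) ^ 2 / 2) : ℂ)‖ := by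
        refine norm_prod_sub_prod_le_sum I _ _ (fun k _ => hφ.norm_le _) fun k _ => ?_
        rw [Complex.norm_real, Real.norm_eq_abs, Real.abs_exp]
        exact Real.exp_le_one_iff.2
          (by nlinarith [sq_nonneg (w k * s + w k * z k * t)])
    _ ≤ ∑ k ∈ I, (c₃ + 3) * |w k * s + w k * z k * t| ^ 3 :=
        Finset.sum_le_sum fun k _ => hφ.norm_sub_exp_le _
    _ ≤ _ := by
        rw [← Finset.mul_sum]
        exact mul_le_mul_of_nonneg_left (h.sum_abs_cube_le hM s t) (by linarith)

end IsStdWeights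

/-- Quantitative local comparison of the characteristic function of a pair of normalized linear
forms with the Gaussian one, in the form needed for expected numbers of zeros. -/
theorem exists_secondDiff_sub_gauss_le {φ φ₁ φ₂ : ℝ → ℂ} {c₂ c₃ D : ℝ}
    (hφ : IsSmoothCharFun φ φ₁ φ₂ c₂ c₃) (hD : 0 < D) :
    ∃ C : ℝ, 0 < C ∧ ∀ (I : Finset ℕ) (w z : ℕ → ℝ) (M lam : ℝ), 0 < M → 0 < lam →
      lam ^ 6 = 1 / M → IsStdWeights I w z M →
      (∀ R : Finset ℕ, R.card ≤ 2 → ∀ s t : ℝ,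
        ∏ k ∈ I \ R, ‖φ (w k * s + w k * z k * t)‖ ≤ D / (1 + s ^ 2 + t ^ 2) ^ 6) →
      ∀ s t : ℝ,
        ‖secondDiff (linCharFun φ I w (fun k => w k * z k)) s t‖ ≤ C / (1 + s ^ 2) * t ^ 2 ∧
        ‖linCharFun φ I w (fun k => w k * z k) s t‖ ≤ C / (1 + s ^ 2) ∧
        ‖secondDiff (linCharFun φ I w (fun k => w k * z k)) s t - secondDiff gaussCharFun s t‖
          ≤ C / (1 + s ^ 2) * min (t ^ 2) (lam ^ 2) := by
  have hc₂ := hφ.const₂_nonneg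
  have hc₃ := hφ.const₃_nonneg
  set C₀ := D * (c₂ * 2 + 2 * c₂ ^ 2 * 2 ^ 2) with hC₀
  have hC₀0 : 0 ≤ C₀ := by positivity
  set K := ((c₃ + 3) * 7) ^ 2 * (D + 92160) + 1 with hK
  have hK1 : 1 ≤ K := by
    have : 0 ≤ ((c₃ + 3) * 7) ^ 2 * (D + 92160) := by positivity
    linarith
  refine ⟨C₀ + D + 2 * K + 1, by positivity, fun I w z M lam hM hlam hlam6 h hprod s t => ?_⟩
  set Φ := linCharFun φ I w (fun k => w k * z k) with hΦ
  have hpow : ∀ s t : ℝ, (1 + s ^ 2 + t ^ 2) ^ 2 ≤ (1 + s ^ 2 + t ^ 2) ^ 6 := fun s t =>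
    pow_le_pow_right₀ (by nlinarith [sq_nonneg s, sq_nonneg t]) (by norm_num)
  have hΦ6 : ∀ s t, ‖Φ s t‖ ≤ D / (1 + s ^ 2 + t ^ 2) ^ 6 := fun s t => by
    have := hprod ∅ (by simp) s t
    rw [Finset.sdiff_empty] at this
    rw [hΦ, linCharFun, norm_prod]
    exact this
  have hsd : ‖secondDiff Φ s t‖ ≤ C₀ / (1 + s ^ 2) * t ^ 2 := by
    refine norm_secondDiff_linCharFun_le hφ I w _ (A := 2) (D := D) ?_ ?_ s t
    · rw [Finset.sum_add_distrib, h.sum_sq]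
      simp only [mul_pow]
      rw [h.sum_sq_mul_sq]; norm_num
    · intro R _ hR s t
      refine (hprod R hR s t).trans ?_
      gcongr
      nlinarith [sq_nonneg s, sq_nonneg t]
      norm_num
  have hdiff : ∀ s t, ‖Φ s t - gaussCharFun s t‖ ≤ K * lam ^ 2 / (1 + s ^ 2) := fun s t => by
    set ρ := Real.sqrt (1 + s ^ 2 + t ^ 2) with hρ
    have hρ2 : ρ ^ 2 = 1 + s ^ 2 + t ^ 2 := Real.sq_sqrt (by positivity)
    have hρ0 : 0 < ρ := Real.sqrt_pos.2 (by positivity)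
    have e1 := h.norm_linCharFun_sub_gauss_le hM hφ s t
    have e2 : ‖Φ s t - gaussCharFun s t‖ ≤ (D + 92160) / ρ ^ 12 := by
      have : ρ ^ 12 = (1 + s ^ 2 + t ^ 2) ^ 6 := by rw [← hρ2]; ring
      rw [this, add_div]
      exact (norm_sub_le _ _).trans (add_le_add (hΦ6 s t) (norm_gaussCharFun_le s t))
    have e3 : Real.sqrt (1 / M) = lam ^ 3 := by
      rw [← hlam6, show lam ^ 6 = (lam ^ 3) ^ 2 by ring, Real.sqrt_sq (by positivity)]
    rw [e3, ← hρ, ← hΦ] at e1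
    set X := ‖Φ s t - gaussCharFun s t‖ with hX
    have hX0 : 0 ≤ X := norm_nonneg _
    -- Interpolation: the Lyapunov bound `ρ ^ 3 * lam ^ 3` is used twice and the decay `ρ ^ (-12)`
    -- once, which leaves `(lam ^ 2 / ρ ^ 2) ^ 3`. The sixth power in the decay hypothesis is chosen
    -- for this.
    have e4 : X ^ 3 ≤ (K * lam ^ 2 / ρ ^ 2) ^ 3 := by
      calc X ^ 3 = X ^ 2 * X := by ring
        _ ≤ ((c₃ + 3) * (7 * (ρ ^ 3 * lam ^ 3))) ^ 2 * ((D + 92160) / ρ ^ 12) := by gcongr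
        _ = (((c₃ + 3) * 7) ^ 2 * (D + 92160)) * (lam ^ 2 / ρ ^ 2) ^ 3 := by
            field_simp
        _ ≤ K ^ 3 * (lam ^ 2 / ρ ^ 2) ^ 3 := by
            gcongr
            have : K ≤ K ^ 3 := le_self_pow₀ hK1 (by norm_num)
            linarith
        _ = _ := by ring
    have e5 : X ≤ K * lam ^ 2 / ρ ^ 2 := le_of_pow_le_pow_left₀ (by norm_num) (by positivity) e4
    refine e5.trans ?_
    rw [hρ2]
    refine div_le_div_of_nonneg_left (by positivity) (by positivity) ?_
    nlinarith [sq_nonneg t]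
  have hs : 0 < 1 + s ^ 2 := by positivity
  refine ⟨hsd.trans ?_, (hΦ6 s t).trans ?_, ?_⟩
  · gcongr; linarith
  · refine div_le_div₀ (by positivity) (by linarith) hs ?_
    calc 1 + s ^ 2 ≤ 1 + s ^ 2 + t ^ 2 := by nlinarith [sq_nonneg t]
      _ ≤ (1 + s ^ 2 + t ^ 2) ^ 6 :=
        le_self_pow₀ (by nlinarith [sq_nonneg s, sq_nonneg t]) (by norm_num)
  · rw [mul_min_of_nonneg _ _ (by positivity)]
    refine le_min ?_ ?_
    · refine (norm_sub_le _ _).trans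
        ((add_le_add hsd (norm_secondDiff_gaussCharFun_le s t)).trans ?_)
      rw [← add_mul, ← add_div]
      gcongr
      linarith
    · rw [secondDiff_sub]
      refine (norm_half_sum_le (hdiff s 0) (hdiff s t) (hdiff s (-t))).trans ?_
      rw [← mul_div_assoc, ← mul_assoc, div_mul_eq_mul_div]
      gcongr
      linarith

/-! ### The absolute value through the kernel `(1 - cos) / t ^ 2` -/

theorem one_sub_cos_div_sq_nonneg (t y : ℝ) : 0 ≤ (1 - Real.cos (t * y)) / t ^ 2 :=
  div_nonneg (sub_nonneg.2 (Real.cos_le_one _)) (sq_nonneg _)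

theorem integrable_one_sub_cos_div_sq :
    Integrable fun t : ℝ => (1 - Real.cos t) / t ^ 2 := by
  refine (integrable_inv_one_add_sq.const_mul 4).mono'
    (by have : Measurable fun t : ℝ => (1 - Real.cos t) / t ^ 2 := by fun_prop
        exact this.aestronglyMeasurable) (ae_of_all _ fun t => ?_)
  have h0 := one_sub_cos_div_sq_nonneg t 1
  rw [mul_one] at h0
  rw [Real.norm_of_nonneg h0, ← div_eq_mul_inv]
  rcases eq_or_ne t 0 with rfl | ht
  · simp
  have ht2 : 0 < t ^ 2 := by positivity
  rw [div_le_div_iff₀ ht2 (by positivity)]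
  have h1 := Real.one_sub_sq_div_two_le_cos (x := t)
  have h2 := Real.neg_one_le_cos t
  nlinarith

/-- The constant `∫ (1 - cos t) / t ^ 2`. -/
noncomputable def cosKernelConst : ℝ := ∫ t : ℝ, (1 - Real.cos t) / t ^ 2

theorem cosKernelConst_pos : 0 < cosKernelConst := by
  rw [cosKernelConst, integral_pos_iff_support_of_nonneg
    (fun t => by simpa using one_sub_cos_div_sq_nonneg t 1) integrable_one_sub_cos_div_sq]
  refine lt_of_lt_of_le ?_ (measure_mono (s := Ioo (0 : ℝ) 1) fun t ht => ?_)
  · simp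
  · have h1 : Real.cos t < 1 := by
      have := Real.cos_lt_cos_of_nonneg_of_le_pi le_rfl (by linarith [ht.2, Real.pi_gt_three]) ht.1
      rwa [Real.cos_zero] at this
    have h2 : 0 < t ^ 2 := pow_pos ht.1 2
    exact (div_pos (by linarith) h2).ne'

theorem integral_one_sub_cos_mul_div_sq (y : ℝ) :
    ∫ t : ℝ, (1 - Real.cos (t * y)) / t ^ 2 = |y| * cosKernelConst := by
  rcases eq_or_ne y 0 with rfl | hy
  · simp
  have h := Measure.integral_comp_mul_right (fun t : ℝ => (1 - Real.cos t) / t ^ 2) y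
  have h1 : ∀ t : ℝ, (1 - Real.cos (t * y)) / t ^ 2
      = y ^ 2 * ((1 - Real.cos (t * y)) / (t * y) ^ 2) := fun t => by
    rcases eq_or_ne t 0 with rfl | ht
    · simp
    · field_simp
  simp_rw [h1]
  rw [integral_const_mul, h, smul_eq_mul, abs_inv, ← sq_abs, cosKernelConst]
  have : |y| ≠ 0 := abs_ne_zero.2 hy
  field_simp

theorem integrable_one_sub_cos_mul_div_sq (y : ℝ) :
    Integrable fun t : ℝ => (1 - Real.cos (t * y)) / t ^ 2 := by
  rcases eq_or_ne y 0 with rfl | hy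
  · simp
  have h1 : ∀ t : ℝ, (1 - Real.cos (t * y)) / t ^ 2
      = y ^ 2 * ((1 - Real.cos (t * y)) / (t * y) ^ 2) := fun t => by
    rcases eq_or_ne t 0 with rfl | ht
    · simp
    · field_simp
  simp_rw [h1]
  exact (integrable_one_sub_cos_div_sq.comp_mul_right' hy).const_mul _

/-- The first absolute moment of `B`, weighted by `g`, through the kernel `(1 - cos) / t ^ 2`. -/
theorem integral_mul_abs_eq {Ω : Type*} [MeasurableSpace Ω] (ν : Measure Ω) [SFinite ν]
    {B : Ω → ℝ} (hBm : Measurable B) (hB : Integrable B ν) {g : Ω → ℂ} (hgm : Measurable g)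
    (hg : ∀ ω, ‖g ω‖ ≤ 1) :
    cosKernelConst * ∫ ω, g ω * |B ω| ∂ν
      = ∫ t : ℝ, (∫ ω, g ω * (1 - Real.cos (t * B ω) : ℝ) ∂ν) / t ^ 2 := by
  have hmeas : AEStronglyMeasurable
      (fun p : Ω × ℝ => (1 - Real.cos (p.2 * B p.1)) / p.2 ^ 2) (ν.prod volume) := by
    have hB' : Measurable fun p : Ω × ℝ => B p.1 := hBm.comp measurable_fst
    have : Measurable fun p : Ω × ℝ => (1 - Real.cos (p.2 * B p.1)) / p.2 ^ 2 := by fun_prop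
    exact this.aestronglyMeasurable
  have hint : Integrable (fun p : Ω × ℝ => (1 - Real.cos (p.2 * B p.1)) / p.2 ^ 2)
      (ν.prod volume) := by
    rw [integrable_prod_iff hmeas]
    refine ⟨ae_of_all _ fun ω => integrable_one_sub_cos_mul_div_sq (B ω), ?_⟩
    have e : ∀ ω, ∫ t : ℝ, ‖(1 - Real.cos (t * B ω)) / t ^ 2‖ = |B ω| * cosKernelConst :=
      fun ω => by
      rw [← integral_one_sub_cos_mul_div_sq]
      exact integral_congr_ae (ae_of_all _ fun t =>
        Real.norm_of_nonneg (one_sub_cos_div_sq_nonneg t (B ω)))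
    simp only [e]
    exact hB.abs.mul_const cosKernelConst
  have hint2 : Integrable (fun p : Ω × ℝ =>
      g p.1 * ((1 - Real.cos (p.2 * B p.1)) / p.2 ^ 2 : ℝ)) (ν.prod volume) := by
    refine hint.mono ?_ (ae_of_all _ fun p => ?_)
    · exact (hgm.comp measurable_fst).aestronglyMeasurable.mul
        (Complex.continuous_ofReal.comp_aestronglyMeasurable hmeas)
    · rw [norm_mul, Complex.norm_real]
      exact mul_le_of_le_one_left (norm_nonneg _) (hg _)
  calc cosKernelConst * ∫ ω, g ω * |B ω| ∂ν
      = ∫ ω, (∫ t : ℝ, g ω * ((1 - Real.cos (t * B ω)) / t ^ 2 : ℝ)) ∂ν := by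
        rw [← integral_const_mul]
        refine integral_congr_ae (ae_of_all _ fun ω => ?_)
        dsimp only
        rw [integral_const_mul, integral_complex_ofReal, integral_one_sub_cos_mul_div_sq]
        push_cast
        ring
    _ = ∫ t : ℝ, (∫ ω, g ω * ((1 - Real.cos (t * B ω)) / t ^ 2 : ℝ) ∂ν) :=
        integral_integral_swap hint2
    _ = _ := by
        refine integral_congr_ae (ae_of_all _ fun t => ?_)
        dsimp only
        rw [← integral_div]
        refine integral_congr_ae (ae_of_all _ fun ω => ?_)
        push_cast
        ring

theorem integral_abs_gaussianReal : ∫ y, |y| ∂(gaussianReal 0 1) = Real.sqrt (2 / Real.pi) := by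
  rw [integral_gaussianReal_eq_integral_smul (by norm_num)]
  have h1 : ∀ y : ℝ, gaussianPDFReal 0 1 y • |y|
      = (Real.sqrt (2 * Real.pi))⁻¹ * ((fun u : ℝ => u * Real.exp (-(1 / 2) * u ^ 2)) |y|) :=
    fun y => by
    simp only [gaussianPDFReal, smul_eq_mul, sq_abs, NNReal.coe_one, mul_one, sub_zero]
    rw [show -y ^ 2 / 2 = -(1 / 2) * y ^ 2 by ring]
    ring
  have h2 : ∫ u in Ioi (0 : ℝ), u * Real.exp (-(1 / 2) * u ^ 2) = 1 := by
    have := integral_mul_cexp_neg_mul_sq (b := 1 / 2) (by norm_num)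
    have e : ∀ u : ℝ, (u : ℂ) * Complex.exp (-(1 / 2) * (u : ℂ) ^ 2)
        = ((u * Real.exp (-(1 / 2) * u ^ 2) : ℝ) : ℂ) := fun u => by push_cast; rfl
    simp_rw [e] at this
    rw [integral_complex_ofReal] at this
    apply Complex.ofReal_injective
    rw [this]; norm_num
  simp_rw [h1]
  rw [integral_const_mul, integral_comp_abs (f := fun u : ℝ => u * Real.exp (-(1 / 2) * u ^ 2)), h2,
    mul_one, Real.sqrt_div (by norm_num),
    Real.sqrt_mul (by norm_num)]
  have h3 : Real.sqrt 2 * Real.sqrt 2 = 2 := Real.mul_self_sqrt (by norm_num)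
  have h4 : 0 < Real.sqrt Real.pi := Real.sqrt_pos.2 Real.pi_pos
  have h5 : 0 < Real.sqrt 2 := by positivity
  field_simp
  nlinarith

/-- The kernel formula for `|y|`, averaged over a standard Gaussian. Evaluating the Gaussian case
with the same kernel lets `cosKernelConst` cancel in the end, so its value is never needed. -/
theorem integral_one_sub_exp_div_sq :
    ∫ t : ℝ, (1 - Real.exp (-t ^ 2 / 2)) / t ^ 2
      = cosKernelConst * Real.sqrt (2 / Real.pi) := by
  have hB : Integrable (fun y : ℝ => y) (gaussianReal 0 1) :=
    (memLp_id_gaussianReal 1).integrable (by norm_num)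
  have h := integral_mul_abs_eq (gaussianReal 0 1) measurable_id hB (g := fun _ => 1)
    measurable_const (by simp)
  simp only [one_mul, id] at h
  rw [integral_complex_ofReal, integral_abs_gaussianReal] at h
  have hcos : ∀ t : ℝ, ∫ y, ((1 - Real.cos (t * y) : ℝ) : ℂ) ∂(gaussianReal 0 1)
      = ((1 - Real.exp (-t ^ 2 / 2) : ℝ) : ℂ) := fun t => by
    rw [integral_complex_ofReal, integral_sub (integrable_const _)]
    · congr 1
      simp only [integral_const, probReal_univ, smul_eq_mul, mul_one]
      congr 1
      have h1 := charFun_gaussianReal (μ := 0) (v := 1) t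
      rw [charFun_apply_real] at h1
      have h2 := congrArg Complex.re h1
      have h3 : Integrable (fun y : ℝ => Complex.exp (t * y * Complex.I)) (gaussianReal 0 1) := by
        refine (integrable_const (1 : ℝ)).mono' (by fun_prop) (ae_of_all _ fun y => ?_)
        rw [← Complex.ofReal_mul, Complex.norm_exp_ofReal_mul_I]
      have h4 := integral_re h3
      simp only [RCLike.re_eq_complex_re] at h4
      rw [← h4] at h2
      have h5 : ∀ y : ℝ, (Complex.exp (t * y * Complex.I)).re = Real.cos (t * y) := fun y => by
        rw [← Complex.ofReal_mul, Complex.exp_ofReal_mul_I_re]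
      simp_rw [h5] at h2
      rw [h2]
      have h6 : (t : ℂ) * ((0 : ℝ) : ℂ) * Complex.I - ((1 : NNReal) : ℝ) * (t : ℂ) ^ 2 / 2
          = ((-t ^ 2 / 2 : ℝ) : ℂ) := by push_cast; simp; ring
      rw [h6, Complex.exp_ofReal_re]
    · refine (integrable_const (1 : ℝ)).mono' (by fun_prop) (ae_of_all _ fun y => ?_)
      exact Real.abs_cos_le_one _
  simp_rw [hcos] at h
  have h7 : ∀ t : ℝ, ((1 - Real.exp (-t ^ 2 / 2) : ℝ) : ℂ) / (t : ℂ) ^ 2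
      = (((1 - Real.exp (-t ^ 2 / 2)) / t ^ 2 : ℝ) : ℂ) := fun t => by push_cast; rfl
  simp_rw [h7] at h
  rw [integral_complex_ofReal] at h
  exact_mod_cast h.symm

/-! ### The Fourier functional and its stability -/

/-- The Fourier expression whose value, divided by `2π` times `cosKernelConst`, is the integral of
`|y|` against the joint density at `(0, y)` of a pair with characteristic function `Φ`. -/
noncomputable def absDensityIntegral (Φ : ℝ → ℝ → ℂ) : ℂ :=
  ∫ p : ℝ × ℝ, secondDiff Φ p.1 p.2 / p.2 ^ 2

/-- The variables separate, and the factors are `√(2π)` and `cosKernelConst * √(2 / π)`. After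
division by `2π * cosKernelConst` this is the limit `1 / π`. -/
theorem absDensityIntegral_gaussCharFun :
    absDensityIntegral gaussCharFun = (2 * cosKernelConst : ℝ) := by
  have h1 : ∀ p : ℝ × ℝ, secondDiff gaussCharFun p.1 p.2 / p.2 ^ 2
      = ((Real.exp (-(1 / 2) * p.1 ^ 2) * ((1 - Real.exp (-p.2 ^ 2 / 2)) / p.2 ^ 2) : ℝ) : ℂ) := by
    rintro ⟨s, t⟩
    have e : ∀ t : ℝ, Real.exp (-(s ^ 2 + t ^ 2) / 2)
        = Real.exp (-(1 / 2) * s ^ 2) * Real.exp (-t ^ 2 / 2) := fun t => by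
      rw [← Real.exp_add]; ring_nf
    simp only [secondDiff, gaussCharFun, e, neg_sq]
    push_cast
    simp
    ring
  rw [absDensityIntegral]
  simp_rw [h1]
  rw [integral_complex_ofReal, Measure.volume_eq_prod,
    integral_prod_mul (fun s : ℝ => Real.exp (-(1 / 2) * s ^ 2))
      (fun t : ℝ => (1 - Real.exp (-t ^ 2 / 2)) / t ^ 2),
    integral_gaussian, integral_one_sub_exp_div_sq]
  congr 1
  have h2 : Real.sqrt (Real.pi / (1 / 2)) * Real.sqrt (2 / Real.pi) = 2 := by
    rw [← Real.sqrt_mul (by positivity)]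
    have : Real.pi / (1 / 2) * (2 / Real.pi) = 2 ^ 2 := by
      have := Real.pi_pos.ne'
      field_simp
    rw [this, Real.sqrt_sq (by norm_num)]
  linear_combination cosKernelConst * h2

/-- The quadratic bound handles small `t` and boundedness handles large `t`. The majorant is
integrable and depends on `Φ` only through `C`, as dominated convergence in a parameter requires. -/
theorem norm_secondDiff_div_sq_le {Φ : ℝ → ℝ → ℂ} {C : ℝ}
    (h1 : ∀ s t, ‖secondDiff Φ s t‖ ≤ C / (1 + s ^ 2) * t ^ 2)
    (h2 : ∀ s t, ‖Φ s t‖ ≤ C / (1 + s ^ 2)) (s t : ℝ) :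
    ‖secondDiff Φ s t / t ^ 2‖ ≤ 4 * C * ((1 + s ^ 2)⁻¹ * (1 + t ^ 2)⁻¹) := by
  have hC : 0 ≤ C := by simpa using (norm_nonneg _).trans (h2 0 0)
  rcases eq_or_ne t 0 with rfl | ht
  · simp; positivity
  have ht2 : 0 < t ^ 2 := by positivity
  have h3 : ‖secondDiff Φ s t‖ ≤ 2 * (C / (1 + s ^ 2)) :=
    norm_half_sum_le (h2 _ _) (h2 _ _) (h2 _ _)
  have h4 : ‖secondDiff Φ s t‖ * (1 + t ^ 2) ≤ 4 * (C / (1 + s ^ 2)) * t ^ 2 := by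
    have := h1 s t
    have e : 0 ≤ C / (1 + s ^ 2) * t ^ 2 := by positivity
    nlinarith
  rw [norm_div, norm_pow, Complex.norm_real, Real.norm_eq_abs, sq_abs, div_le_iff₀ ht2]
  calc ‖secondDiff Φ s t‖ ≤ 4 * (C / (1 + s ^ 2)) * t ^ 2 / (1 + t ^ 2) := by
        rwa [le_div_iff₀ (by positivity)]
    _ = _ := by field_simp

theorem integrable_inv_one_add_sq_mul :
    Integrable fun p : ℝ × ℝ => (1 + p.1 ^ 2)⁻¹ * (1 + p.2 ^ 2)⁻¹ :=
  integrable_inv_one_add_sq.mul_prod integrable_inv_one_add_sq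

theorem continuous_uncurry_secondDiff {Φ : ℝ → ℝ → ℂ} (hΦ : Continuous (Function.uncurry Φ)) :
    Continuous fun p : ℝ × ℝ => secondDiff Φ p.1 p.2 := by
  have h1 : Continuous fun p : ℝ × ℝ => Φ p.1 0 := hΦ.comp (by fun_prop : Continuous
    fun p : ℝ × ℝ => (p.1, (0 : ℝ)))
  have h2 : Continuous fun p : ℝ × ℝ => Φ p.1 p.2 := hΦ
  have h3 : Continuous fun p : ℝ × ℝ => Φ p.1 (-p.2) := hΦ.comp (by fun_prop : Continuous
    fun p : ℝ × ℝ => (p.1, -p.2))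
  exact h1.sub ((h2.add h3).div_const 2)

theorem integrable_secondDiff_div_sq {Φ : ℝ → ℝ → ℂ} (hΦ : Continuous (Function.uncurry Φ)) {C : ℝ}
    (h1 : ∀ s t, ‖secondDiff Φ s t‖ ≤ C / (1 + s ^ 2) * t ^ 2)
    (h2 : ∀ s t, ‖Φ s t‖ ≤ C / (1 + s ^ 2)) :
    Integrable fun p : ℝ × ℝ => secondDiff Φ p.1 p.2 / (p.2 : ℂ) ^ 2 := by
  refine (integrable_inv_one_add_sq_mul.const_mul (4 * C)).mono' ?_
    (ae_of_all _ fun p => norm_secondDiff_div_sq_le h1 h2 _ _)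
  have h3 : Measurable fun p : ℝ × ℝ => secondDiff Φ p.1 p.2 :=
    (continuous_uncurry_secondDiff hΦ).measurable
  have : Measurable fun p : ℝ × ℝ => secondDiff Φ p.1 p.2 / (p.2 : ℂ) ^ 2 := by fun_prop
  exact this.aestronglyMeasurable

/-- Since `min (t ^ 2) (lam ^ 2) / t ^ 2` is at most `2 / (1 + (t / lam) ^ 2)`, the `t`-integral is
at most `2 * π * lam`. The `s`-integral contributes another `π`. -/
theorem norm_absDensityIntegral_sub_le {Φ Ψ : ℝ → ℝ → ℂ} {C lam : ℝ} (hlam : 0 < lam)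
    (hΦ : Integrable fun p : ℝ × ℝ => secondDiff Φ p.1 p.2 / (p.2 : ℂ) ^ 2)
    (hΨ : Integrable fun p : ℝ × ℝ => secondDiff Ψ p.1 p.2 / (p.2 : ℂ) ^ 2)
    (h : ∀ s t, ‖secondDiff Φ s t - secondDiff Ψ s t‖
      ≤ C / (1 + s ^ 2) * min (t ^ 2) (lam ^ 2)) :
    ‖absDensityIntegral Φ - absDensityIntegral Ψ‖ ≤ 2 * C * Real.pi ^ 2 * lam := by
  have hC : 0 ≤ C := by
    have h0 := (norm_nonneg _).trans (h 0 lam)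
    have : 0 < min (lam ^ 2) (lam ^ 2) := lt_min (by positivity) (by positivity)
    simp at h0
    exact nonneg_of_mul_nonneg_left h0 (by positivity)
  have hb : ∀ p : ℝ × ℝ, ‖secondDiff Φ p.1 p.2 / (p.2 : ℂ) ^ 2
      - secondDiff Ψ p.1 p.2 / (p.2 : ℂ) ^ 2‖
      ≤ 2 * C * ((1 + p.1 ^ 2)⁻¹ * (1 + (p.2 / lam) ^ 2)⁻¹) := by
    rintro ⟨s, t⟩
    rw [← sub_div, norm_div, norm_pow, Complex.norm_real, Real.norm_eq_abs, sq_abs]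
    dsimp only
    rcases eq_or_ne t 0 with rfl | ht
    · simp; positivity
    have ht2 : 0 < t ^ 2 := by positivity
    rw [div_le_iff₀ ht2]
    refine (h s t).trans ?_
    have h1 : min (t ^ 2) (lam ^ 2) ≤ 2 * ((1 + (t / lam) ^ 2)⁻¹ * t ^ 2) := by
      rw [← div_eq_inv_mul, ← mul_div_assoc, le_div_iff₀ (by positivity), mul_add, div_pow]
      have e1 : min (t ^ 2) (lam ^ 2) ≤ t ^ 2 := min_le_left _ _
      have e2 : min (t ^ 2) (lam ^ 2) * (t ^ 2 / lam ^ 2) ≤ lam ^ 2 * (t ^ 2 / lam ^ 2) :=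
        mul_le_mul_of_nonneg_right (min_le_right _ _) (by positivity)
      have e3 : lam ^ 2 * (t ^ 2 / lam ^ 2) = t ^ 2 := by field_simp
      linarith
    calc C / (1 + s ^ 2) * min (t ^ 2) (lam ^ 2)
        ≤ C / (1 + s ^ 2) * (2 * ((1 + (t / lam) ^ 2)⁻¹ * t ^ 2)) := by gcongr
      _ = _ := by ring
  have hI2 : Integrable fun t : ℝ => (1 + (t / lam) ^ 2)⁻¹ :=
    integrable_inv_one_add_sq.comp_div hlam.ne'
  have hI : Integrable fun p : ℝ × ℝ =>
      2 * C * ((1 + p.1 ^ 2)⁻¹ * (1 + (p.2 / lam) ^ 2)⁻¹) :=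
    (integrable_inv_one_add_sq.mul_prod hI2).const_mul _
  rw [absDensityIntegral, absDensityIntegral, ← integral_sub hΦ hΨ]
  refine (norm_integral_le_of_norm_le hI (ae_of_all _ hb)).trans (le_of_eq ?_)
  rw [integral_const_mul, Measure.volume_eq_prod,
    integral_prod_mul (fun s : ℝ => (1 + s ^ 2)⁻¹) (fun t : ℝ => (1 + (t / lam) ^ 2)⁻¹),
    integral_univ_inv_one_add_sq, Measure.integral_comp_div (fun t : ℝ => (1 + t ^ 2)⁻¹),
    integral_univ_inv_one_add_sq, abs_of_pos hlam, smul_eq_mul]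
  ring

/-! ### Binomial moments and the largest binomial probability -/

/-- The expectation of `F` under the binomial law with parameters `n` and `p`, where `q = 1 - p`. -/
noncomputable def binomialExp (p q : ℝ) (n : ℕ) (F : ℕ → ℝ) : ℝ :=
  ∑ k ∈ Finset.range (n + 1), (n.choose k : ℝ) * p ^ k * q ^ (n - k) * F k

/-- Conditioning on one trial, that is, Pascal's rule. All moments below follow from it by induction
on `n`. -/
theorem binomialExp_succ (p q : ℝ) (n : ℕ) (F : ℕ → ℝ) :
    binomialExp p q (n + 1) F = binomialExp p q n fun k => q * F k + p * F (k + 1) := by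
  have h1 : ∑ k ∈ Finset.range (n + 1),
      (n.choose (k + 1) : ℝ) * p ^ (k + 1) * q ^ (n - k) * F (k + 1) + q ^ (n + 1) * F 0
      = ∑ k ∈ Finset.range (n + 1), (n.choose k : ℝ) * p ^ k * q ^ (n - k) * (q * F k) := by
    rw [Finset.sum_range_succ, Finset.sum_range_succ' (n := n)]
    simp only [Nat.choose_succ_self, Nat.cast_zero, zero_mul, add_zero, Nat.choose_zero_right,
      Nat.cast_one, pow_zero, one_mul, tsub_zero]
    congr 1
    · refine Finset.sum_congr rfl fun k hk => ?_
      have hk' := Finset.mem_range.1 hk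
      have : n - k = n - (k + 1) + 1 := by omega
      rw [this, pow_succ]; ring
    · ring
  rw [binomialExp, binomialExp, Finset.sum_range_succ']
  simp only [mul_add, Finset.sum_add_distrib, ← h1]
  simp only [Nat.choose_succ_succ, Nat.cast_add, add_mul, Finset.sum_add_distrib,
    Nat.choose_zero_right, Nat.cast_one, pow_zero, one_mul, tsub_zero, Nat.add_sub_add_right]
  have h2 : ∑ k ∈ Finset.range (n + 1), (n.choose k : ℝ) * p ^ (k + 1) * q ^ (n - k) * F (k + 1)
      = ∑ k ∈ Finset.range (n + 1), (n.choose k : ℝ) * p ^ k * q ^ (n - k) * (p * F (k + 1)) :=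
    Finset.sum_congr rfl fun k _ => by ring
  rw [← h2]
  ring

theorem binomialExp_add (p q : ℝ) (n : ℕ) (F G : ℕ → ℝ) :
    binomialExp p q n (fun k => F k + G k) = binomialExp p q n F + binomialExp p q n G := by
  simp only [binomialExp, mul_add, Finset.sum_add_distrib]

theorem binomialExp_const_mul (p q : ℝ) (n : ℕ) (c : ℝ) (F : ℕ → ℝ) :
    binomialExp p q n (fun k => c * F k) = c * binomialExp p q n F := by
  simp only [binomialExp, Finset.mul_sum]
  exact Finset.sum_congr rfl fun k _ => by ring

theorem binomialExp_mono {p q : ℝ} (hp : 0 ≤ p) (hq : 0 ≤ q) (n : ℕ) {F G : ℕ → ℝ}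
    (h : ∀ k, F k ≤ G k) : binomialExp p q n F ≤ binomialExp p q n G :=
  Finset.sum_le_sum fun k _ => mul_le_mul_of_nonneg_left (h k) (by positivity)

theorem binomialExp_one {p q : ℝ} (hpq : p + q = 1) (n : ℕ) :
    binomialExp p q n (fun _ => 1) = 1 := by
  induction n with
  | zero => simp [binomialExp]
  | succ n ih => rw [binomialExp_succ]; simpa [add_comm q p, hpq] using ih

theorem binomialExp_centered {p q : ℝ} (hpq : p + q = 1) (n : ℕ) :
    binomialExp p q n (fun k => k - n * p) = 0 := by
  induction n with
  | zero => simp [binomialExp]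
  | succ n ih =>
    rw [binomialExp_succ, ← ih]
    congr 1
    ext k
    push_cast
    obtain rfl : q = 1 - p := by linarith
    ring

theorem binomialExp_sq {p q : ℝ} (hpq : p + q = 1) (n : ℕ) :
    binomialExp p q n (fun k => (k - n * p) ^ 2) = n * p * q := by
  induction n with
  | zero => simp [binomialExp]
  | succ n ih =>
    have : (fun k : ℕ => q * ((k : ℝ) - (n + 1 : ℕ) * p) ^ 2
        + p * (((k + 1 : ℕ) : ℝ) - (n + 1 : ℕ) * p) ^ 2)
        = fun k : ℕ => ((k : ℝ) - n * p) ^ 2 + p * q * 1 := by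
      ext k
      push_cast
      obtain rfl : q = 1 - p := by linarith
      ring
    rw [binomialExp_succ, this, binomialExp_add, ih, binomialExp_const_mul, binomialExp_one hpq]
    push_cast
    ring

theorem binomialExp_fourth_le {p q : ℝ} (hpq : p + q = 1) (hp : 0 ≤ p) (hq : 0 ≤ q)
    (n : ℕ) :
    binomialExp p q n (fun k => (k - n * p) ^ 4) ≤ 3 * (n * p * q) ^ 2 + n * p * q := by
  induction n with
  | zero => simp [binomialExp]
  | succ n ih =>
    have : (fun k : ℕ => q * ((k : ℝ) - (n + 1 : ℕ) * p) ^ 4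
        + p * (((k + 1 : ℕ) : ℝ) - (n + 1 : ℕ) * p) ^ 4)
        = fun k : ℕ => ((k : ℝ) - n * p) ^ 4 + ((6 * p * q) * ((k : ℝ) - n * p) ^ 2
          + ((4 * p * q * (q ^ 2 - p ^ 2)) * ((k : ℝ) - n * p) + p * q * (p ^ 3 + q ^ 3) * 1)) := by
      ext k
      push_cast
      obtain rfl : q = 1 - p := by linarith
      ring
    rw [binomialExp_succ, this, binomialExp_add, binomialExp_add, binomialExp_add,
      binomialExp_const_mul, binomialExp_const_mul, binomialExp_const_mul, binomialExp_one hpq,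
      binomialExp_sq hpq, binomialExp_centered hpq]
    have h1 : p ^ 3 + q ^ 3 ≤ 1 := by
      have : p ^ 3 + q ^ 3 = 1 - 3 * (p * q) := by
        obtain rfl : q = 1 - p := by linarith
        ring
      nlinarith [mul_nonneg hp hq]
    have h2 : 0 ≤ p * q := mul_nonneg hp hq
    have h3 : p * q * (p ^ 3 + q ^ 3) ≤ p * q := mul_le_of_le_one_right h2 h1
    push_cast
    nlinarith [sq_nonneg (p * q)]

/-- Averaging `|y| ≤ y ^ 2 / (2 * σ) + σ / 2` with `σ` the standard deviation takes the place of
Cauchy-Schwarz. -/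
theorem binomialExp_abs_le {p q : ℝ} (hpq : p + q = 1) (hp : 0 < p) (hq : 0 < q) (n : ℕ) :
    binomialExp p q (n + 1) (fun k => |(k : ℝ) - (n + 1 : ℕ) * p|)
      ≤ Real.sqrt ((n + 1 : ℕ) * p * q) := by
  set σ := Real.sqrt ((n + 1 : ℕ) * p * q) with hσ
  have hσ0 : 0 < σ := Real.sqrt_pos.2 (by positivity)
  have hσ2 : σ ^ 2 = (n + 1 : ℕ) * p * q := Real.sq_sqrt (by positivity)
  calc _ ≤ binomialExp p q (n + 1) (fun k => (1 / (2 * σ)) * ((k : ℝ) - (n + 1 : ℕ) * p) ^ 2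
        + (σ / 2) * 1) := by
        refine binomialExp_mono hp.le hq.le _ fun k => ?_
        have := sq_nonneg (|(k : ℝ) - (n + 1 : ℕ) * p| - σ)
        rw [sub_sq, sq_abs] at this
        rw [one_div_mul_eq_div, mul_one, ← sub_nonneg]
        have e : ((k : ℝ) - (n + 1 : ℕ) * p) ^ 2 / (2 * σ) + σ / 2
            - |(k : ℝ) - (n + 1 : ℕ) * p| = (((k : ℝ) - (n + 1 : ℕ) * p) ^ 2
              - 2 * |(k : ℝ) - (n + 1 : ℕ) * p| * σ + σ ^ 2) / (2 * σ) := by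
          field_simp; ring
        rw [e]
        exact div_nonneg this (by positivity)
    _ = σ := by
        rw [binomialExp_add, binomialExp_const_mul, binomialExp_const_mul, binomialExp_one hpq,
          binomialExp_sq hpq, ← hσ2]
        field_simp; ring

/-- De Moivre's identity: the partial sums of the centred first moment telescope to a single
binomial probability, with one trial fewer. -/
theorem binomial_mul_eq_neg_sum {p q : ℝ} (hpq : p + q = 1) (n k : ℕ) (hk : k ≤ n) :
    ((n + 1 : ℕ) * p * q) * ((n.choose k : ℝ) * p ^ k * q ^ (n - k))
      = -∑ j ∈ Finset.range (k + 1), ((n + 1).choose j : ℝ) * p ^ j * q ^ (n + 1 - j)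
        * ((j : ℝ) - (n + 1 : ℕ) * p) := by
  induction k with
  | zero => simp; ring
  | succ k ih =>
    obtain ⟨m, rfl⟩ : ∃ m, n = k + 1 + m := Nat.exists_eq_add_of_le hk
    have h0 := ih (by omega)
    rw [Finset.sum_range_succ, neg_add, ← h0]
    have e1 : k + 1 + m - k = m + 1 := by omega
    have e2 : k + 1 + m - (k + 1) = m := by omega
    have e3 : k + 1 + m + 1 - (k + 1) = m + 1 := by omega
    rw [e1, e2, e3]
    have c1 : ((k + 1 + m + 1 : ℕ) : ℝ) * ((k + 1 + m).choose k : ℝ)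
        = ((k + 1 + m + 1).choose (k + 1) : ℝ) * ((k + 1 : ℕ) : ℝ) := by
      exact_mod_cast Nat.add_one_mul_choose_eq (k + 1 + m) k
    have c2 : ((k + 1 + m).choose (k + 1) : ℝ) * ((k + 1 + m + 1 : ℕ) : ℝ)
        = ((k + 1 + m + 1).choose (k + 1) : ℝ) * ((m + 1 : ℕ) : ℝ) := by
      have := Nat.choose_mul_succ_eq (k + 1 + m) (k + 1)
      rw [e3] at this
      exact_mod_cast this
    have c3 : ((k + 1 + m + 1 : ℕ) : ℝ) = ((k + 1 : ℕ) : ℝ) + ((m + 1 : ℕ) : ℝ) := by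
      push_cast; ring
    obtain rfl : q = 1 - p := by linarith
    rw [c3] at c1 c2 ⊢
    linear_combination (p * (1 - p) * p ^ (k + 1) * (1 - p) ^ m) * c2
      - (p * (1 - p) * p ^ k * (1 - p) ^ (m + 1)) * c1

/-- In De Moivre's identity the partial sum is at most the mean absolute deviation, hence at most
the standard deviation. No Stirling estimate is involved. -/
theorem binomial_le {p q : ℝ} (hpq : p + q = 1) (hp : 0 < p) (hq : 0 < q) (n k : ℕ) (hk : k ≤ n) :
    (n.choose k : ℝ) * p ^ k * q ^ (n - k) ≤ 1 / Real.sqrt ((n + 1 : ℕ) * p * q) := by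
  set v : ℝ := (n + 1 : ℕ) * p * q with hv
  have hv0 : 0 < v := by positivity
  have h1 : v * ((n.choose k : ℝ) * p ^ k * q ^ (n - k)) ≤ Real.sqrt v := by
    rw [hv, binomial_mul_eq_neg_sum hpq n k hk, ← Finset.sum_neg_distrib]
    refine le_trans ?_ (binomialExp_abs_le hpq hp hq n)
    calc _ ≤ ∑ j ∈ Finset.range (k + 1), ((n + 1).choose j : ℝ) * p ^ j * q ^ (n + 1 - j)
          * |(j : ℝ) - (n + 1 : ℕ) * p| := by
          refine Finset.sum_le_sum fun j _ => ?_
          rw [← mul_neg]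
          exact mul_le_mul_of_nonneg_left (neg_le_abs _) (by positivity)
      _ ≤ _ := Finset.sum_le_sum_of_subset_of_nonneg
          (Finset.range_subset_range.2 (by omega)) fun _ _ _ => by positivity
  rw [le_div_iff₀ (Real.sqrt_pos.2 hv0)]
  have h2 : v = Real.sqrt v * Real.sqrt v := (Real.mul_self_sqrt hv0.le).symm
  have h3 := Real.sqrt_pos.2 hv0
  have h4 : Real.sqrt v * (Real.sqrt v * ((n.choose k : ℝ) * p ^ k * q ^ (n - k)))
      ≤ Real.sqrt v * 1 := by rwa [← mul_assoc, ← h2, mul_one]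
  rw [mul_comm]
  exact le_of_mul_le_mul_left h4 h3

/-! ### The normalized coefficients of the random polynomial -/

/-- The coefficient of `c k` in `f_n(x)`, normalized to unit variance. -/
noncomputable def so2Weight (n : ℕ) (x : ℝ) (k : ℕ) : ℝ :=
  Real.sqrt (n.choose k : ℝ) * x ^ k / Real.sqrt ((1 + x ^ 2) ^ n)

/-- The standardized position of the index `k` under the binomial law with parameter
`x ^ 2 / (1 + x ^ 2)`. -/
noncomputable def so2Pos (n : ℕ) (x : ℝ) (k : ℕ) : ℝ :=
  (k * (1 + x ^ 2) - n * x ^ 2) / (Real.sqrt n * x)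

theorem so2Weight_sq (n : ℕ) (x : ℝ) (k : ℕ) (hk : k ≤ n) :
    so2Weight n x k ^ 2
      = (n.choose k : ℝ) * (x ^ 2 / (1 + x ^ 2)) ^ k * (1 / (1 + x ^ 2)) ^ (n - k) := by
  have h1 : 0 < 1 + x ^ 2 := by positivity
  rw [so2Weight, div_pow, mul_pow, Real.sq_sqrt (by positivity), Real.sq_sqrt (by positivity),
    div_pow, div_pow, one_pow]
  have h2 : (1 + x ^ 2) ^ n = (1 + x ^ 2) ^ k * (1 + x ^ 2) ^ (n - k) := by
    rw [← pow_add]; congr 1; omega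
  rw [h2]
  field_simp
  ring

theorem sum_so2Weight_sq_mul (n : ℕ) (x : ℝ) (F : ℕ → ℝ) :
    ∑ k ∈ Finset.range (n + 1), so2Weight n x k ^ 2 * F k
      = binomialExp (x ^ 2 / (1 + x ^ 2)) (1 / (1 + x ^ 2)) n F :=
  Finset.sum_congr rfl fun k hk => by
    rw [so2Weight_sq n x k (by have := Finset.mem_range.1 hk; omega)]

/-- Away from `0` and `∞` one has `p * q = (|x| / (1 + x ^ 2)) ^ 2 ≥ δ ^ 2 / 4`, which gives the
atom bound. The condition on `n` makes `n * p * q ≥ 1`, so the standardized fourth moment `3 + 1 /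
(n * p * q)` is at most `4`. -/
theorem isStdWeights_so2 {n : ℕ} {x δ : ℝ} (hδ : 0 < δ) (hx : x ∈ awayFromZero δ)
    (hn : 4 / δ ^ 2 ≤ n) :
    IsStdWeights (Finset.range (n + 1)) (so2Weight n x) (so2Pos n x) (Real.sqrt n * δ / 2) := by
  have hn0 : 0 < (n : ℝ) := lt_of_lt_of_le (by positivity) hn
  have hx0 : 0 < |x| := lt_of_lt_of_le hδ hx.1
  have hxne : x ≠ 0 := abs_pos.1 hx0
  have hx2 : 0 < x ^ 2 := by positivity
  have h1x : 0 < 1 + x ^ 2 := by positivity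
  set p := x ^ 2 / (1 + x ^ 2) with hp
  set q := 1 / (1 + x ^ 2) with hq
  have hp0 : 0 < p := by positivity
  have hq0 : 0 < q := by positivity
  have hpq : p + q = 1 := by rw [hp, hq]; field_simp; ring
  have hsn : 0 < Real.sqrt n := Real.sqrt_pos.2 hn0
  have hsn2 : Real.sqrt n ^ 2 = n := Real.sq_sqrt hn0.le
  set c := (1 + x ^ 2) / (Real.sqrt n * x) with hc
  have hz : ∀ k : ℕ, so2Pos n x k = c * (k - n * p) := fun k => by
    rw [so2Pos, hc, hp]; field_simp
  have hc2 : c ^ 2 = 1 / (n * p * q) := by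
    rw [hc, hp, hq, div_pow, mul_pow, hsn2]; field_simp
  have hpqδ : δ ^ 2 / 4 ≤ p * q := by
    have e1 : p * q = (|x| / (1 + x ^ 2)) ^ 2 := by
      rw [hp, hq, div_pow, sq_abs]; field_simp
    have e2 : δ / 2 ≤ |x| / (1 + x ^ 2) := by
      rw [div_le_div_iff₀ two_pos h1x, ← sq_abs]
      have f1 : δ * |x| ≤ 1 := by
        calc δ * |x| ≤ δ * δ⁻¹ := by gcongr; exact hx.2
          _ = 1 := mul_inv_cancel₀ hδ.ne'
      have f2 := hx.1
      nlinarith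
    rw [e1]
    calc δ ^ 2 / 4 = (δ / 2) ^ 2 := by ring
      _ ≤ _ := by gcongr
  have hv1 : 1 ≤ n * p * q := by
    rw [mul_assoc]
    calc (1 : ℝ) = 4 / δ ^ 2 * (δ ^ 2 / 4) := by field_simp
      _ ≤ n * (p * q) := by gcongr
  refine ⟨?_, ?_, ?_, ?_, ?_⟩
  · have := sum_so2Weight_sq_mul n x fun _ => 1
    rw [binomialExp_one hpq] at this
    simpa using this
  · simp_rw [hz]
    rw [sum_so2Weight_sq_mul n x fun k => c * ((k : ℝ) - n * p), binomialExp_const_mul,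
      binomialExp_centered hpq, mul_zero]
  · simp_rw [hz, mul_pow]
    rw [sum_so2Weight_sq_mul n x fun k => c ^ 2 * ((k : ℝ) - n * p) ^ 2, binomialExp_const_mul,
      binomialExp_sq hpq, hc2]
    field_simp
  · simp_rw [hz, mul_pow]
    rw [sum_so2Weight_sq_mul n x fun k => c ^ 4 * ((k : ℝ) - n * p) ^ 4, binomialExp_const_mul]
    have h4 := binomialExp_fourth_le hpq hp0.le hq0.le n
    have e : c ^ 4 = 1 / (n * p * q) ^ 2 := by
      rw [show c ^ 4 = (c ^ 2) ^ 2 by ring, hc2, div_pow, one_pow]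
    rw [e, one_div_mul_eq_div, div_le_iff₀ (by positivity)]
    nlinarith
  · intro k hk
    rw [so2Weight_sq n x k (by have := Finset.mem_range.1 hk; omega)]
    refine (binomial_le hpq hp0 hq0 n k (by have := Finset.mem_range.1 hk; omega)).trans ?_
    refine one_div_le_one_div_of_le (by positivity) (Real.le_sqrt_of_sq_le ?_)
    rw [div_pow, mul_pow, hsn2]
    push_cast
    nlinarith [mul_pos hp0 hq0]

/-! ### Parseval's formula for a density against a measure -/

open scoped FourierTransform in
/-- Parseval's formula for a finite measure with integrable characteristic function and a bounded
continuous density. -/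
theorem integral_comp_neg_eq_integral_charFun {μ : Measure ℝ} [IsFiniteMeasure μ]
    (hμ : Integrable (charFun μ)) {k : ℝ → ℝ} (hk : Continuous k) (hk0 : ∀ t, 0 ≤ k t) {C : ℝ}
    (hkC : ∀ t, k t ≤ C) (hki : Integrable k) :
    ((∫ u, k (-u) ∂μ : ℝ) : ℂ) = (2 * Real.pi)⁻¹ *
      ∫ s, charFun (volume.withDensity fun t => ENNReal.ofReal (k t)) s * charFun μ s := by
  set ν := volume.withDensity fun t => ENNReal.ofReal (k t) with hν
  have : IsFiniteMeasure ν := isFiniteMeasure_withDensity_ofReal hki.2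
  have hνs : ∀ s : ℝ, charFun ν s = ∫ t : ℝ, Complex.exp (s * t * Complex.I) * k t := fun s => by
    rw [charFun_apply_real, hν, integral_withDensity_eq_integral_toReal_smul (by fun_prop)
      (ae_of_all _ fun _ => ENNReal.ofReal_lt_top)]
    refine integral_congr_ae (ae_of_all _ fun t => ?_)
    dsimp only
    rw [ENNReal.toReal_ofReal (hk0 t), Complex.real_smul, mul_comm]
  -- `K` is the continuous density of the convolution of `ν` and `μ`. Its Fourier transform is the
  -- product of the characteristic functions, and inversion at `0` is the claim.
  set K : ℝ → ℂ := fun y => ∫ u, (k (y - u) : ℂ) ∂μ with hK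
  have hint : Integrable (fun p : ℝ × ℝ => (k (p.1 - p.2) : ℂ)) (volume.prod μ) := by
    have hm : AEStronglyMeasurable (fun p : ℝ × ℝ => (k (p.1 - p.2) : ℂ)) (volume.prod μ) := by
      have : Continuous fun p : ℝ × ℝ => (k (p.1 - p.2) : ℂ) := by fun_prop
      exact this.aestronglyMeasurable
    rw [integrable_prod_iff' hm]
    refine ⟨ae_of_all _ fun u => (hki.comp_sub_right u).ofReal, ?_⟩
    have e : ∀ u : ℝ, ∫ y : ℝ, ‖(k (y - u) : ℂ)‖ = ∫ y : ℝ, ‖(k y : ℂ)‖ := fun u =>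
      integral_sub_right_eq_self (fun y : ℝ => ‖(k y : ℂ)‖) u
    simp only [e]
    exact integrable_const _
  have hKi : Integrable K := hint.integral_prod_left
  have hKc : Continuous K := by
    refine continuous_of_dominated (bound := fun _ => C) (fun y => ?_) (fun y => ?_)
      (integrable_const _) (ae_of_all _ fun u => by fun_prop)
    · have : Continuous fun u : ℝ => (k (y - u) : ℂ) := by fun_prop
      exact this.aestronglyMeasurable
    · refine ae_of_all _ fun u => ?_
      rw [Complex.norm_real, Real.norm_of_nonneg (hk0 _)]
      exact hkC _
  have hF : ∀ w : ℝ, 𝓕 K w = charFun ν (-2 * Real.pi * w) * charFun μ (-2 * Real.pi * w) := by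
    intro w
    rw [Real.fourier_real_eq_integral_exp_smul]
    set f : ℝ → ℝ → ℂ := fun y u => Complex.exp ((-2 * Real.pi * y * w : ℝ) * Complex.I)
      * k (y - u) with hf
    have h1 : Integrable (Function.uncurry f) (volume.prod μ) := by
      refine hint.mono ?_ (ae_of_all _ fun p => ?_)
      · have : Continuous (Function.uncurry f) := by
          simp only [hf, Function.uncurry_def]; fun_prop
        exact this.aestronglyMeasurable
      · simp only [Function.uncurry, hf]
        rw [norm_mul, Complex.norm_exp_ofReal_mul_I, one_mul]
    calc ∫ y : ℝ, Complex.exp ((-2 * Real.pi * y * w : ℝ) * Complex.I) • K y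
        = ∫ y : ℝ, ∫ u, f y u ∂μ := by
          refine integral_congr_ae (ae_of_all _ fun y => ?_)
          simp only [hf, smul_eq_mul, hK]
          rw [integral_const_mul]
      _ = ∫ u, (∫ y : ℝ, f y u) ∂μ := integral_integral_swap h1
      _ = ∫ u, charFun ν (-2 * Real.pi * w)
            * Complex.exp ((-2 * Real.pi * w : ℝ) * u * Complex.I) ∂μ := by
          refine integral_congr_ae (ae_of_all _ fun u => ?_)
          dsimp only
          rw [← integral_add_right_eq_self (fun y => f y u) u, hνs, ← integral_mul_const]
          refine integral_congr_ae (ae_of_all _ fun y => ?_)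
          simp only [hf, add_sub_cancel_right]
          have e : Complex.exp ((-2 * Real.pi * (y + u) * w : ℝ) * Complex.I)
              = Complex.exp ((-2 * Real.pi * w : ℝ) * y * Complex.I)
                * Complex.exp ((-2 * Real.pi * w : ℝ) * u * Complex.I) := by
            rw [← Complex.exp_add]; push_cast; ring_nf
          rw [e]
          ring
      _ = _ := by
          rw [integral_const_mul, ← charFun_apply_real]
  have hGi : Integrable fun s => charFun ν s * charFun μ s :=
    hμ.bdd_mul (c := ν.real univ) measurable_charFun.aestronglyMeasurable
      (ae_of_all _ fun s => norm_charFun_le s)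
  have hpi : -2 * Real.pi ≠ 0 := by
    have := Real.pi_pos
    linarith
  have hFi : Integrable (𝓕 K) := by
    have := hGi.comp_mul_left' hpi
    rwa [show 𝓕 K = _ from funext hF]
  have hinv := hKi.fourierInv_fourier_eq hFi (v := 0) hKc.continuousAt
  rw [Real.fourierInv_eq'] at hinv
  simp only [inner_zero_right, mul_zero, Complex.ofReal_zero, zero_mul, Complex.exp_zero,
    one_smul, hF] at hinv
  rw [Measure.integral_comp_mul_left (fun s => charFun ν s * charFun μ s)] at hinv
  have habs : |(-2 * Real.pi)⁻¹| = (2 * Real.pi)⁻¹ := by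
    rw [abs_inv, neg_mul, abs_neg, abs_of_pos (by have := Real.pi_pos; positivity)]
  rw [habs, Complex.real_smul] at hinv
  have hK0 : K 0 = ((∫ u, k (-u) ∂μ : ℝ) : ℂ) := by
    simp only [hK, zero_sub]
    exact integral_complex_ofReal
  rw [hK0] at hinv
  exact hinv.symm

/-- Parseval's formula for a finite measure with integrable characteristic function and a
nonnegative continuous integrable function, which may be unbounded. -/
theorem lintegral_comp_neg_eq_integral_charFun {μ : Measure ℝ} [IsFiniteMeasure μ]
    (hμ : Integrable (charFun μ)) {r : ℝ → ℝ} (hr : Continuous r) (hr0 : ∀ t, 0 ≤ r t)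
    (hri : Integrable r) :
    ∫⁻ u, ENNReal.ofReal (r (-u)) ∂μ = ENNReal.ofReal ((2 * Real.pi)⁻¹ *
      ∫ s, charFun (volume.withDensity fun t => ENNReal.ofReal (r t)) s * charFun μ s).re := by
  -- Truncating `r` at height `j` gives the bounded case. The left side converges monotonically and
  -- the right side dominatedly, with majorant `(∫ r) * ‖charFun μ‖`.
  set k : ℕ → ℝ → ℝ := fun j t => min (r t) j with hk
  have hk0 : ∀ j t, 0 ≤ k j t := fun j t => le_min (hr0 t) j.cast_nonneg
  have hkc : ∀ j, Continuous (k j) := fun j => hr.min continuous_const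
  have hkr : ∀ j t, k j t ≤ r t := fun j t => min_le_left _ _
  have hki : ∀ j, Integrable (k j) := fun j => hri.mono' (hkc j).aestronglyMeasurable
    (ae_of_all _ fun t => by rw [Real.norm_of_nonneg (hk0 j t)]; exact hkr j t)
  have hklim : ∀ t, Tendsto (fun j => k j t) atTop (nhds (r t)) := fun t => by
    refine tendsto_const_nhds.congr' ?_
    obtain ⟨j₀, hj₀⟩ := exists_nat_ge (r t)
    filter_upwards [eventually_ge_atTop j₀] with j hj
    exact (min_eq_left (hj₀.trans (by exact_mod_cast hj))).symm
  have hL : Tendsto (fun j => ∫⁻ u, ENNReal.ofReal (k j (-u)) ∂μ) atTop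
      (nhds (∫⁻ u, ENNReal.ofReal (r (-u)) ∂μ)) := by
    refine lintegral_tendsto_of_tendsto_of_monotone (fun j => ?_) (ae_of_all _ fun u => ?_)
      (ae_of_all _ fun u => (ENNReal.continuous_ofReal.tendsto _).comp (hklim (-u)))
    · have := (hkc j).measurable
      fun_prop
    · intro i j hij
      exact ENNReal.ofReal_le_ofReal (min_le_min le_rfl (by exact_mod_cast hij))
  have hchar : ∀ (f : ℝ → ℝ), Continuous f → (∀ t, 0 ≤ f t) → ∀ s : ℝ,
      charFun (volume.withDensity fun t => ENNReal.ofReal (f t)) s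
        = ∫ t : ℝ, f t * Complex.exp (s * t * Complex.I) := fun f hf hf0 s => by
    rw [charFun_apply_real, integral_withDensity_eq_integral_toReal_smul
      (by have := hf.measurable; fun_prop) (ae_of_all _ fun _ => ENNReal.ofReal_lt_top)]
    refine integral_congr_ae (ae_of_all _ fun t => ?_)
    dsimp only
    rw [ENNReal.toReal_ofReal (hf0 t), Complex.real_smul]
  have hexp : ∀ s t : ℝ, ‖Complex.exp (s * t * Complex.I)‖ = 1 := fun s t => by
    rw [← Complex.ofReal_mul, Complex.norm_exp_ofReal_mul_I]
  have hcharlim : ∀ s, Tendsto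
      (fun j => charFun (volume.withDensity fun t => ENNReal.ofReal (k j t)) s) atTop
      (nhds (charFun (volume.withDensity fun t => ENNReal.ofReal (r t)) s)) := fun s => by
    rw [hchar r hr hr0]
    simp_rw [fun j => hchar (k j) (hkc j) (hk0 j) s]
    refine tendsto_integral_of_dominated_convergence r (fun j => ?_) hri
      (fun j => ae_of_all _ fun t => ?_) (ae_of_all _ fun t => ?_)
    · have := hkc j
      have : Continuous fun t : ℝ => (k j t : ℂ) * Complex.exp (s * t * Complex.I) := by fun_prop
      exact this.aestronglyMeasurable
    · rw [norm_mul, hexp, mul_one, Complex.norm_real, Real.norm_of_nonneg (hk0 j t)]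
      exact hkr j t
    · exact ((Complex.continuous_ofReal.tendsto _).comp (hklim t)).mul_const _
  have hbound : ∀ j s, ‖charFun (volume.withDensity fun t => ENNReal.ofReal (k j t)) s‖
      ≤ ∫ t, r t := fun j s => by
    rw [hchar (k j) (hkc j) (hk0 j)]
    refine norm_integral_le_of_norm_le hri (ae_of_all _ fun t => ?_)
    rw [norm_mul, hexp, mul_one, Complex.norm_real, Real.norm_of_nonneg (hk0 j t)]
    exact hkr j t
  have hR : Tendsto (fun j => ∫ s, charFun (volume.withDensity fun t => ENNReal.ofReal (k j t)) s
      * charFun μ s) atTop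
      (nhds (∫ s, charFun (volume.withDensity fun t => ENNReal.ofReal (r t)) s * charFun μ s)) := by
    refine tendsto_integral_of_dominated_convergence (fun s => (∫ t, r t) * ‖charFun μ s‖)
      (fun j => ?_) (hμ.norm.const_mul _) (fun j => ae_of_all _ fun s => ?_)
      (ae_of_all _ fun s => (hcharlim s).mul_const _)
    · have : IsFiniteMeasure (volume.withDensity fun t => ENNReal.ofReal (k j t)) :=
        isFiniteMeasure_withDensity_ofReal (hki j).2
      exact (measurable_charFun.mul measurable_charFun).aestronglyMeasurable
    · rw [norm_mul]
      exact mul_le_mul_of_nonneg_right (hbound j s) (norm_nonneg _)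
  have hj : ∀ j, ∫⁻ u, ENNReal.ofReal (k j (-u)) ∂μ = ENNReal.ofReal ((2 * Real.pi)⁻¹ *
      ∫ s, charFun (volume.withDensity fun t => ENNReal.ofReal (k j t)) s * charFun μ s).re :=
    fun j => by
    have hb : Integrable (fun u => k j (-u)) μ := by
      refine (integrable_const (j : ℝ)).mono' ((hkc j).comp continuous_neg).aestronglyMeasurable
        (ae_of_all _ fun u => ?_)
      rw [Real.norm_of_nonneg (hk0 j _)]
      exact min_le_right _ _
    rw [← integral_comp_neg_eq_integral_charFun hμ (hkc j) (hk0 j) (C := j)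
      (fun t => min_le_right _ _) (hki j), Complex.ofReal_re,
      ofReal_integral_eq_lintegral_ofReal hb (ae_of_all _ fun u => hk0 j _)]
  refine tendsto_nhds_unique hL ?_
  simp_rw [hj]
  exact (ENNReal.continuous_ofReal.tendsto _).comp
    ((Complex.continuous_re.tendsto _).comp (hR.const_mul _))

/-! ### The Kac-Rice integrand in Fourier form -/

section LinearForms

variable {Ω : Type*} [MeasurableSpace Ω] {P : Measure Ω} {c : ℕ → Ω → ℝ}
  {φ : ℝ → ℂ}

theorem integral_exp_linearForms (hc_meas : ∀ k, Measurable (c k)) (hc_indep : iIndepFun c P)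
    (hφ : ∀ k, φ = charFun (P.map (c k))) (I : Finset ℕ) (a b : ℕ → ℝ) (s t : ℝ) :
    ∫ ω, Complex.exp ((s * (∑ k ∈ I, a k * c k ω) + t * ∑ k ∈ I, b k * c k ω : ℝ) * Complex.I) ∂P
      = linCharFun φ I a b s t := by
  set X : ℕ → Ω → ℝ := fun k ω => (a k * s + b k * t) * c k ω with hX
  have hXm : ∀ k, Measurable (X k) := fun k => (hc_meas k).const_mul _
  have hXi : iIndepFun (I.restrict X) P := by
    have := hc_indep.comp (fun k y => (a k * s + b k * t) * y) (fun k => by fun_prop)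
    exact this.precomp (g := fun i : I => (i : ℕ)) Subtype.val_injective
  have h := congrFun (hXi.charFun_map_fun_finsetSum_eq_prod
    (s := I) (X := X) fun i _ => (hXm i).aemeasurable) 1
  rw [charFun_apply_real, integral_map
    (by have := Finset.measurable_sum I (f := X) fun i _ => hXm i
        exact (by simpa [Finset.sum_fn] using this : Measurable _).aemeasurable)
    (by fun_prop)] at h
  rw [Finset.prod_apply] at h
  rw [linCharFun]
  convert! h using 1
  · refine integral_congr_ae (ae_of_all _ fun ω => ?_)
    simp only [hX, Complex.ofReal_one, one_mul]
    congr 3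
    rw [Finset.mul_sum, Finset.mul_sum, ← Finset.sum_add_distrib]
    exact Finset.sum_congr rfl fun k _ => by ring
  · refine Finset.prod_congr rfl fun k _ => ?_
    rw [hX, charFun_map_mul_comp (hc_meas k).aemeasurable, ← hφ k, mul_one]

theorem integral_exp_mul_one_sub_cos [IsProbabilityMeasure P]
    (hc_meas : ∀ k, Measurable (c k)) (hc_indep : iIndepFun c P)
    (hφ : ∀ k, φ = charFun (P.map (c k))) (I : Finset ℕ) (a b : ℕ → ℝ) (s t : ℝ) :
    ∫ ω, Complex.exp (s * (∑ k ∈ I, a k * c k ω : ℝ) * Complex.I)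
        * (1 - Real.cos (t * ∑ k ∈ I, b k * c k ω) : ℝ) ∂P
      = secondDiff (linCharFun φ I a b) s t := by
  have hA : Measurable fun ω => ∑ k ∈ I, a k * c k ω := by fun_prop
  have hB : Measurable fun ω => ∑ k ∈ I, b k * c k ω := by fun_prop
  have hi : ∀ t : ℝ, Integrable (fun ω => Complex.exp
      ((s * (∑ k ∈ I, a k * c k ω) + t * ∑ k ∈ I, b k * c k ω : ℝ) * Complex.I)) P := fun t => by
    refine (integrable_const (1 : ℝ)).mono' (by fun_prop) (ae_of_all _ fun ω => ?_)
    rw [Complex.norm_exp_ofReal_mul_I]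
  rw [secondDiff, ← integral_exp_linearForms hc_meas hc_indep hφ I a b s 0,
    ← integral_exp_linearForms hc_meas hc_indep hφ I a b s t,
    ← integral_exp_linearForms hc_meas hc_indep hφ I a b s (-t), ← integral_add (hi _) (hi _),
    ← integral_div]
  have hsub := integral_sub (hi 0) (((hi t).add (hi (-t))).div_const 2)
  simp only [Pi.add_apply] at hsub
  rw [← hsub]
  refine integral_congr_ae (ae_of_all _ fun ω => ?_)
  simp only [Complex.ofReal_sub, Complex.ofReal_one, Complex.ofReal_cos]
  generalize (∑ k ∈ I, a k * c k ω) = A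
  generalize (∑ k ∈ I, b k * c k ω) = B
  rw [Complex.cos]
  have e : ∀ t : ℝ, Complex.exp ((s * A + t * B : ℝ) * Complex.I)
      = Complex.exp (s * A * Complex.I) * Complex.exp (t * B * Complex.I) := fun t => by
    rw [← Complex.exp_add]; push_cast; ring_nf
  rw [e, e, e]
  push_cast
  simp
  ring

/-- The conditional Kac-Rice density at level `0`, where the coefficient of one more independent
variable with density `r` and characteristic function `φ` is `1` in the first form and `0` in the
second. -/
theorem lintegral_abs_mul_density_eq [IsProbabilityMeasure P]
    (hc_meas : ∀ k, Measurable (c k)) (hc_indep : iIndepFun c P)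
    (hφ : ∀ k, φ = charFun (P.map (c k))) (hc_int : ∀ k, Integrable (c k) P)
    {r : ℝ → ℝ} (hr : Continuous r) (hr0 : ∀ t, 0 ≤ r t)
    (hri : Integrable r) (hφr : φ = charFun (volume.withDensity fun t => ENNReal.ofReal (r t)))
    (hφc : Continuous φ) (hφ1 : ∀ s, ‖φ s‖ ≤ 1)
    (I : Finset ℕ) (a b : ℕ → ℝ)
    (hI : Integrable fun p : ℝ × ℝ => secondDiff (linCharFun φ I a b) p.1 p.2 / (p.2 : ℂ) ^ 2) :
    ∫⁻ ω, ENNReal.ofReal (|∑ k ∈ I, b k * c k ω| * r (-∑ k ∈ I, a k * c k ω)) ∂P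
      = ENNReal.ofReal ((2 * Real.pi * cosKernelConst : ℝ)⁻¹ *
          absDensityIntegral fun s t => φ s * linCharFun φ I a b s t).re := by
  set A : Ω → ℝ := fun ω => ∑ k ∈ I, a k * c k ω with hA
  set B : Ω → ℝ := fun ω => ∑ k ∈ I, b k * c k ω with hB
  have hAm : Measurable A := by fun_prop
  have hBm : Measurable B := by fun_prop
  have hBi : Integrable B P := integrable_finsetSum _ fun k _ => (hc_int k).const_mul _
  -- Weighting `P` by `|B|` and pushing forward along `A` reduces the claim to Parseval on the line.
  -- The kernel formula computes the characteristic function of this measure.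
  set ρ := P.withDensity fun ω => ENNReal.ofReal |B ω| with hρ
  have : IsFiniteMeasure ρ := isFiniteMeasure_withDensity_ofReal hBi.abs.2
  set μ := ρ.map A with hμ
  have hc0 := cosKernelConst_pos
  have hψ : ∀ s : ℝ, charFun μ s = (cosKernelConst : ℂ)⁻¹ *
      ∫ t : ℝ, secondDiff (linCharFun φ I a b) s t / (t : ℂ) ^ 2 := fun s => by
    have h1 := integral_mul_abs_eq P hBm hBi
      (g := fun ω => Complex.exp (s * (A ω : ℝ) * Complex.I)) (by fun_prop) (fun ω => by
        rw [← Complex.ofReal_mul, Complex.norm_exp_ofReal_mul_I])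
    have h2 : ∀ t : ℝ, ∫ ω, Complex.exp (s * (A ω : ℝ) * Complex.I)
        * (1 - Real.cos (t * B ω) : ℝ) ∂P = secondDiff (linCharFun φ I a b) s t :=
      integral_exp_mul_one_sub_cos hc_meas hc_indep hφ I a b s
    simp_rw [h2] at h1
    rw [← h1, ← mul_assoc, inv_mul_cancel₀ (by exact_mod_cast hc0.ne'), one_mul,
      charFun_apply_real, hμ, integral_map hAm.aemeasurable (by fun_prop), hρ,
      integral_withDensity_eq_integral_toReal_smul (by fun_prop)
        (ae_of_all _ fun _ => ENNReal.ofReal_lt_top)]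
    refine integral_congr_ae (ae_of_all _ fun ω => ?_)
    dsimp only
    rw [ENNReal.toReal_ofReal (abs_nonneg _), Complex.real_smul, mul_comm]
  have hμi : Integrable (charFun μ) := by
    rw [show charFun μ = _ from funext hψ]
    exact hI.integral_prod_left.const_mul _
  have hL : ∫⁻ ω, ENNReal.ofReal (|B ω| * r (-A ω)) ∂P = ∫⁻ u, ENNReal.ofReal (r (-u)) ∂μ := by
    have hrm := hr.measurable
    rw [hμ, lintegral_map (by fun_prop) hAm, hρ, lintegral_withDensity_eq_lintegral_mul _
      (by fun_prop) (by fun_prop)]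
    refine lintegral_congr fun ω => ?_
    rw [Pi.mul_apply, ENNReal.ofReal_mul (abs_nonneg _)]
  rw [hL, lintegral_comp_neg_eq_integral_charFun hμi hr hr0 hri, ← hφr]
  congr 2
  have hsd : ∀ p : ℝ × ℝ, secondDiff (fun s t => φ s * linCharFun φ I a b s t) p.1 p.2 / p.2 ^ 2
      = φ p.1 * (secondDiff (linCharFun φ I a b) p.1 p.2 / p.2 ^ 2) := fun p => by
    simp only [secondDiff]; ring
  have hI2 : Integrable fun p : ℝ × ℝ =>
      φ p.1 * (secondDiff (linCharFun φ I a b) p.1 p.2 / (p.2 : ℂ) ^ 2) :=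
    hI.bdd_mul (c := 1) (by
      have : Continuous fun p : ℝ × ℝ => φ p.1 := hφc.comp continuous_fst
      exact this.aestronglyMeasurable) (ae_of_all _ fun p => hφ1 _)
  rw [absDensityIntegral, integral_congr_ae (ae_of_all _ hsd)]
  simp_rw [hψ]
  rw [Measure.volume_eq_prod] at hI2 ⊢
  rw [integral_prod _ hI2]
  simp only [integral_const_mul]
  simp_rw [mul_left_comm (φ _) _ _]
  rw [integral_const_mul, ← mul_assoc]
  push_cast
  rw [mul_inv_rev, mul_inv_rev]
  ring

end LinearForms

/-! ### Measurability of the zero count and the area formula -/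

/-- Finitely many distinct points fall into different cells of length `1 / m` once `m` is large.
Counting zeros thus reduces to deciding whether a cell contains one. -/
theorem encard_eq_iSup_encard_image_floor (S : Set ℝ) :
    S.encard = ⨆ m : ℕ, ((fun x : ℝ => ⌊(m : ℝ) * x⌋) '' S).encard := by
  refine le_antisymm ?_ (iSup_le fun m => encard_image_le _ _)
  rw [← ENat.forall_natCast_le_iff_le]
  intro k hk
  obtain ⟨T, hTS, hT⟩ := exists_subset_encard_eq hk
  have hTf : T.Finite := finite_of_encard_eq_coe hT
  have hev : ∀ᶠ m : ℕ in atTop, ∀ x ∈ T, ∀ y ∈ T, x ≠ y → ⌊(m : ℝ) * x⌋ ≠ ⌊(m : ℝ) * y⌋ := by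
    refine (eventually_all_finite hTf).2 fun x _ => (eventually_all_finite hTf).2 fun y _ => ?_
    rcases eq_or_ne x y with rfl | hxy
    · simp
    have hpos : 0 < |x - y| := abs_pos.2 (sub_ne_zero.2 hxy)
    obtain ⟨m₀, hm₀⟩ := exists_nat_ge (1 / |x - y|)
    filter_upwards [eventually_ge_atTop m₀] with m hm _ hfl
    have h1 := Int.abs_sub_lt_one_of_floor_eq_floor hfl
    rw [← mul_sub, abs_mul, Nat.abs_cast] at h1
    have h2 : 1 / |x - y| ≤ m := hm₀.trans (by exact_mod_cast hm)
    rw [div_le_iff₀ hpos] at h2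
    linarith
  obtain ⟨m, hm⟩ := hev.exists
  have hinj : InjOn (fun x : ℝ => ⌊(m : ℝ) * x⌋) T := fun x hx y hy h => by
    by_contra hne
    exact hm x hx y hy hne h
  rw [← hT, ← hinj.encard_image]
  exact (encard_le_encard (image_mono hTS)).trans (le_iSup_iff.2 fun b hb => hb m)

theorem toENNReal_encard_eq_tsum (T : Set ℤ) :
    ((T.encard : ℕ∞) : ℝ≥0∞) = ∑' i : ℤ, T.indicator 1 i := by
  rw [← ENNReal.tsum_set_one, ← tsum_subtype]
  rfl

/-- The number of zeros in a compact interval is a measurable function of a parameter on which the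
function depends continuously. -/
theorem measurable_encard_zeros {E : Type*} [TopologicalSpace E] [MeasurableSpace E]
    [OpensMeasurableSpace E] {F : E → ℝ → ℝ} (hF : Continuous (Function.uncurry F)) (a b : ℝ) :
    Measurable fun y => (({x : ℝ | x ∈ Icc a b ∧ F y x = 0}.encard : ℕ∞) : ℝ≥0∞) := by
  simp_rw [encard_eq_iSup_encard_image_floor, ENat.toENNReal_iSup, toENNReal_encard_eq_tsum]
  refine Measurable.iSup fun m => Measurable.tsum fun i => ?_
  have hclosed : ∀ K : Set ℝ, IsCompact K → IsClosed {y : E | ∃ x ∈ K, F y x = 0} :=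
    fun K hK => by
    have := isCompact_iff_compactSpace.1 hK
    have hc : IsClosed {p : E × K | F p.1 p.2 = 0} :=
      isClosed_eq (hF.comp (by fun_prop : Continuous fun p : E × K => (p.1, (p.2 : ℝ))))
        continuous_const
    convert! isClosedMap_fst_of_compactSpace _ hc using 1
    ext y
    simp
  have hmeas : MeasurableSet
      {y : E | i ∈ (fun x : ℝ => ⌊(m : ℝ) * x⌋) '' {x | x ∈ Icc a b ∧ F y x = 0}} := by
    -- A half-open cell is a countable union of compact ones, and for a compact set the condition of
    -- containing a zero is closed.
    have hU : {y : E | i ∈ (fun x : ℝ => ⌊(m : ℝ) * x⌋) '' {x | x ∈ Icc a b ∧ F y x = 0}}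
        = ⋃ j : ℕ, {y : E | ∃ x ∈ Icc a b ∩ {x : ℝ | (i : ℝ) ≤ m * x ∧
            (m : ℝ) * x ≤ i + 1 - 1 / ((j : ℝ) + 1)}, F y x = 0} := by
      ext y
      simp only [mem_ofPred_eq, mem_image, mem_iUnion, mem_inter_iff]
      constructor
      · rintro ⟨x, ⟨hx, hF0⟩, hfl⟩
        rw [Int.floor_eq_iff] at hfl
        obtain ⟨j, hj⟩ := exists_nat_one_div_lt (sub_pos.2 hfl.2)
        exact ⟨j, x, ⟨hx, hfl.1, by linarith⟩, hF0⟩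
      · rintro ⟨j, x, ⟨hx, h1, h2⟩, hF0⟩
        refine ⟨x, ⟨hx, hF0⟩, Int.floor_eq_iff.2 ⟨h1, lt_of_le_of_lt h2 ?_⟩⟩
        have : 0 < 1 / ((j : ℝ) + 1) := by positivity
        linarith
    rw [hU]
    refine MeasurableSet.iUnion fun j => (hclosed _ (isCompact_Icc.inter_right ?_)).measurableSet
    have hm : Continuous fun x : ℝ => (m : ℝ) * x := by fun_prop
    exact (isClosed_le continuous_const hm).inter (isClosed_le hm continuous_const)
  exact (measurable_const (a := (1 : ℝ≥0∞))).indicator hmeas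

/-- The one-dimensional area formula for a polynomial function. -/
theorem lintegral_encard_fiber_mul (Q : Polynomial ℝ) {s : Set ℝ} (hs : MeasurableSet s)
    {r : ℝ → ℝ≥0∞} (hr : Measurable r) :
    ∫⁻ t, (({x | x ∈ s ∧ Q.eval x = t}.encard : ℕ∞) : ℝ≥0∞) * r t
      = ∫⁻ x in s, ENNReal.ofReal |Q.derivative.eval x| * r (Q.eval x) := by
  classical
  -- A constant `Q` has an empty fibre over all but one value, so both sides vanish.
  by_cases hQ : Q.derivative = 0
  · have h1 : Q = Polynomial.C (Q.coeff 0) := Polynomial.eq_C_of_derivative_eq_zero hQ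
    rw [hQ]
    simp only [Polynomial.eval_zero, abs_zero, ENNReal.ofReal_zero, zero_mul, lintegral_zero]
    rw [← lintegral_zero (μ := (volume : Measure ℝ))]
    refine lintegral_congr_ae ?_
    have h2 : ∀ᵐ t : ℝ, t ≠ Q.coeff 0 := by simp [ae_iff]
    filter_upwards [h2] with t ht
    have : {x | x ∈ s ∧ Q.eval x = t} = ∅ := by
      rw [h1]
      ext x
      simp [ht.symm]
    simp [this]
  set Z := Q.derivative.roots.toFinset with hZ
  have hZmem : ∀ x, x ∈ Z ↔ Q.derivative.eval x = 0 := fun x => by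
    simp [hZ, Polynomial.mem_roots hQ]
  -- `N x` counts the critical points below `x`. Off the critical points, `Q` is injective on each
  -- level set of `N` by Rolle's theorem, and the change of variables formula applies to each piece.
  set N : ℝ → ℕ := fun x => (Z.filter (· < x)).card with hN
  have hNm : Measurable N := by
    refine Monotone.measurable fun x y hxy => Finset.card_le_card fun z hz => ?_
    simp only [Finset.mem_filter] at hz ⊢
    exact ⟨hz.1, hz.2.trans_le hxy⟩
  set A : ℕ → Set ℝ := fun j => s ∩ (Z : Set ℝ)ᶜ ∩ N ⁻¹' {j} with hA
  have hAm : ∀ j, MeasurableSet (A j) := fun j =>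
    (hs.inter Z.measurableSet.compl).inter (hNm (measurableSet_singleton j))
  have hdisj : ∀ J : Set ℕ, J.PairwiseDisjoint A := fun J i _ j _ hij => by
    refine disjoint_left.2 fun x hx hx' => hij ?_
    exact hx.2.symm.trans hx'.2
  have hinj : ∀ j, InjOn (fun x => Q.eval x) (A j) := by
    have key : ∀ j, ∀ x ∈ A j, ∀ y ∈ A j, x < y → Q.eval x ≠ Q.eval y := fun j x hx y hy hxy h => by
      obtain ⟨z, hz, hz0⟩ := exists_deriv_eq_zero hxy Q.continuous.continuousOn h
      rw [Polynomial.deriv] at hz0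
      have hzZ := (hZmem z).2 hz0
      have hlt : N x < N y := by
        refine Finset.card_lt_card (Finset.ssubset_iff_of_subset (fun u hu => ?_) |>.2 ⟨z, ?_, ?_⟩)
        · simp only [Finset.mem_filter] at hu ⊢
          exact ⟨hu.1, hu.2.trans hxy⟩
        · simp [hzZ, hz.2]
        · simp [hz.1.le]
      have h1 : N x = j := hx.2
      have h2 : N y = j := hy.2
      omega
    intro j x hx y hy h
    rcases lt_trichotomy x y with hlt | heq | hgt
    · exact absurd h (key j x hx y hy hlt)
    · exact heq
    · exact absurd h.symm (key j y hy x hx hgt)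
  set J := Finset.range (Z.card + 1) with hJ
  have hU : ⋃ j ∈ J, A j = s \ Z := by
    ext x
    simp only [hA, hJ, mem_iUnion, mem_inter_iff, mem_compl_iff, Finset.mem_coe, mem_preimage,
      mem_singleton_iff, Finset.mem_range, Set.mem_sdiff, exists_prop]
    constructor
    · rintro ⟨j, _, h, _⟩
      exact h
    · intro h
      exact ⟨N x, Nat.lt_succ_of_le (Finset.card_filter_le _ _), h, rfl⟩
  have hQc : Continuous fun x => Q.eval x := Q.continuous
  have himg : ∀ j, MeasurableSet ((fun x => Q.eval x) '' A j) := fun j =>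
    (hAm j).image_of_continuousOn_injOn hQc.continuousOn (hinj j)
  have hcount : ∀ᵐ t : ℝ, (({x | x ∈ s ∧ Q.eval x = t}.encard : ℕ∞) : ℝ≥0∞) * r t
      = ∑ j ∈ J, ((fun x => Q.eval x) '' A j).indicator r t := by
    have hnull : ∀ᵐ t : ℝ, t ∉ (fun x => Q.eval x) '' (Z : Set ℝ) := by
      exact compl_mem_ae_iff.2 ((Z.finite_toSet.image fun x => Q.eval x).measure_zero volume)
    filter_upwards [hnull] with t ht
    have hfib : MeasurableSet ((fun x => Q.eval x) ⁻¹' {t}) :=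
      hQc.measurable (measurableSet_singleton t)
    have h1 : {x | x ∈ s ∧ Q.eval x = t} = ⋃ j ∈ J, A j ∩ (fun x => Q.eval x) ⁻¹' {t} := by
      rw [← iUnion₂_inter, hU]
      ext x
      simp only [mem_ofPred_eq, mem_inter_iff, Set.mem_sdiff, mem_preimage, mem_singleton_iff]
      constructor
      · rintro ⟨hxs, hxt⟩
        exact ⟨⟨hxs, fun hxZ => ht ⟨x, hxZ, hxt⟩⟩, hxt⟩
      · rintro ⟨⟨hxs, _⟩, hxt⟩
        exact ⟨hxs, hxt⟩
    have h2 : MeasurableSet {x | x ∈ s ∧ Q.eval x = t} := hs.inter hfib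
    rw [← Measure.count_apply h2, h1, measure_biUnion_finset
      (fun i hi j hj hij => (hdisj _ hi hj hij).mono inter_subset_left inter_subset_left)
      (fun j _ => (hAm j).inter hfib), Finset.sum_mul]
    refine Finset.sum_congr rfl fun j _ => ?_
    by_cases hmem : t ∈ (fun x => Q.eval x) '' A j
    · obtain ⟨x, hx, hxt⟩ := id hmem
      have h3 : A j ∩ (fun x => Q.eval x) ⁻¹' {t} = {x} := by
        ext y
        simp only [mem_inter_iff, mem_preimage, mem_singleton_iff]
        constructor
        · rintro ⟨hy, hyt⟩
          exact hinj j hy hx (hyt.trans hxt.symm)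
        · rintro rfl
          exact ⟨hx, hxt⟩
      rw [h3, Measure.count_singleton, one_mul,  indicator_of_mem hmem]
    · have h3 : A j ∩ (fun x => Q.eval x) ⁻¹' {t} = ∅ := by
        ext y
        simp only [mem_inter_iff, mem_preimage, mem_singleton_iff, mem_empty_iff_false, iff_false]
        rintro ⟨hy, hyt⟩
        exact hmem ⟨y, hy, hyt⟩
      rw [h3, measure_empty, zero_mul, indicator_of_notMem hmem]
  rw [lintegral_congr_ae hcount, lintegral_finsetSum _ fun j _ => hr.indicator (himg j)]
  have hpiece : ∀ j, ∫⁻ t, ((fun x => Q.eval x) '' A j).indicator r t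
      = ∫⁻ x in A j, ENNReal.ofReal |Q.derivative.eval x| * r (Q.eval x) := fun j => by
    rw [lintegral_indicator (himg j)]
    exact lintegral_image_eq_lintegral_abs_deriv_mul (hAm j)
      (fun x _ => (Q.hasDerivAt x).hasDerivWithinAt) (hinj j) r
  simp_rw [hpiece]
  rw [← lintegral_biUnion_finset (hdisj _) (fun j _ => hAm j), hU]
  exact setLIntegral_congr (sdiff_null_ae_eq_self (Z.finite_toSet.measure_zero volume))

/-! ### The Kac-Rice formula for the random polynomial -/

/-- The coefficient of `c k` in `f_n(x)`. -/
noncomputable def so2Coeff (n : ℕ) (x : ℝ) (k : ℕ) : ℝ := Real.sqrt (n.choose k : ℝ) * x ^ k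

/-- The coefficient of `c k` in the derivative of `f_n` at `x`. -/
noncomputable def so2DerivCoeff (n : ℕ) (x : ℝ) (k : ℕ) : ℝ :=
  Real.sqrt (n.choose k : ℝ) * (k * x ^ (k - 1))

/-- The indices `1, …, n`. -/
def posRange (n : ℕ) : Finset ℕ := (Finset.range (n + 1)).erase 0

/-- The Kac-Rice density of the zeros of `f_n`, in the form that one gets by conditioning on the
coefficients other than the constant one. -/
noncomputable def so2KacRice {Ω : Type*} [MeasurableSpace Ω] (P : Measure Ω) (c : ℕ → Ω → ℝ)
    (r : ℝ → ℝ) (n : ℕ) (x : ℝ) : ℝ≥0∞ :=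
  ∫⁻ ω, ENNReal.ofReal (|∑ k ∈ posRange n, so2DerivCoeff n x k * c k ω|
    * r (-∑ k ∈ posRange n, so2Coeff n x k * c k ω)) ∂P

/-- Minus the nonconstant part of `f_n`. -/
noncomputable def so2NegTail (n : ℕ) (y : ℕ → ℝ) : Polynomial ℝ :=
  -∑ k ∈ posRange n, Polynomial.C (Real.sqrt (n.choose k : ℝ) * y k) * Polynomial.X ^ k

theorem eval_so2NegTail (n : ℕ) (y : ℕ → ℝ) (x : ℝ) :
    (so2NegTail n y).eval x = -∑ k ∈ posRange n, so2Coeff n x k * y k := by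
  simp only [so2NegTail, Polynomial.eval_neg, Polynomial.eval_finsetSum, Polynomial.eval_mul,
    Polynomial.eval_C, Polynomial.eval_pow, Polynomial.eval_X, so2Coeff]
  congr 1
  exact Finset.sum_congr rfl fun k _ => by ring

theorem eval_derivative_so2NegTail (n : ℕ) (y : ℕ → ℝ) (x : ℝ) :
    (so2NegTail n y).derivative.eval x = -∑ k ∈ posRange n, so2DerivCoeff n x k * y k := by
  simp only [so2NegTail, Polynomial.derivative_neg, Polynomial.derivative_sum,
    Polynomial.derivative_C_mul_X_pow, Polynomial.eval_neg, Polynomial.eval_finsetSum,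
    Polynomial.eval_mul, Polynomial.eval_C, Polynomial.eval_pow, Polynomial.eval_X, so2DerivCoeff]
  congr 1
  exact Finset.sum_congr rfl fun k _ => by ring

theorem so2Poly_eq (c : ℕ → ℝ) (n : ℕ) (x : ℝ) :
    so2Poly c n x = c 0 - (so2NegTail n c).eval x := by
  rw [eval_so2NegTail, so2Poly, posRange, sub_neg_eq_add,
    ← Finset.add_sum_erase _ _ (Finset.mem_range.2 n.succ_pos)]
  congr 1
  · simp
  · exact Finset.sum_congr rfl fun k _ => by simp only [so2Coeff]; ring

theorem so2NegTail_congr {n : ℕ} {y y' : ℕ → ℝ} (h : ∀ k ∈ posRange n, y k = y' k) :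
    so2NegTail n y = so2NegTail n y' := by
  rw [so2NegTail, so2NegTail]
  congr 1
  exact Finset.sum_congr rfl fun k hk => by rw [h k hk]

/-- A nonzero constant term ensures that the polynomial is not zero, so its degree bounds the number
of its roots. -/
theorem encard_zeros_so2Poly_le (c : ℕ → ℝ) (n : ℕ) (hc : c 0 ≠ 0) (a b : ℝ) :
    {x : ℝ | x ∈ Icc a b ∧ so2Poly c n x = 0}.encard ≤ n := by
  set p : Polynomial ℝ := Polynomial.C (c 0) - so2NegTail n c with hp
  have hev : ∀ x, p.eval x = so2Poly c n x := fun x => by simp [hp, so2Poly_eq]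
  have hp0 : p ≠ 0 := fun h => hc <| by
    have h1 := hev 0
    rw [h, Polynomial.eval_zero, so2Poly_eq, eval_so2NegTail] at h1
    have h2 : ∑ k ∈ posRange n, so2Coeff n 0 k * c k = 0 := by
      refine Finset.sum_eq_zero fun k hk => ?_
      have : k ≠ 0 := Finset.ne_of_mem_erase hk
      simp [so2Coeff, this]
    rw [h2] at h1
    linarith
  have hdeg : p.natDegree ≤ n := by
    refine (Polynomial.natDegree_sub_le _ _).trans (max_le (by simp) ?_)
    rw [so2NegTail, Polynomial.natDegree_neg]
    refine Polynomial.natDegree_sum_le_of_forall_le _ _ fun k hk => ?_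
    refine (Polynomial.natDegree_C_mul_X_pow_le _ _).trans ?_
    have := Finset.mem_range.1 (Finset.mem_of_mem_erase hk)
    omega
  calc {x : ℝ | x ∈ Icc a b ∧ so2Poly c n x = 0}.encard
      ≤ (p.roots.toFinset : Set ℝ).encard := by
        refine encard_le_encard fun x hx => ?_
        simp only [Finset.mem_coe, Multiset.mem_toFinset, Polynomial.mem_roots hp0,
          Polynomial.IsRoot.def, hev]
        exact hx.2
    _ = (p.roots.toFinset.card : ℕ∞) := encard_coe_eq_coe_finsetCard _
    _ ≤ n := by
        exact_mod_cast (Multiset.toFinset_card_le _).trans ((Polynomial.card_roots' p).trans hdeg)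

section

variable {Ω : Type*} [MeasurableSpace Ω] {P : Measure Ω} [IsProbabilityMeasure P] {c : ℕ → Ω → ℝ}
  {r : ℝ → ℝ}

theorem measurable_so2KacRice (hc_meas : ∀ k, Measurable (c k)) (hr : Measurable r) (n : ℕ) :
    Measurable (so2KacRice P c r n) := by
  refine Measurable.lintegral_prod_right' (f := fun p : ℝ × Ω =>
    ENNReal.ofReal (|∑ k ∈ posRange n, so2DerivCoeff n p.1 k * c k p.2|
      * r (-∑ k ∈ posRange n, so2Coeff n p.1 k * c k p.2))) ?_
  have h2 : ∀ k, Measurable fun p : ℝ × Ω => c k p.2 := fun k => (hc_meas k).comp measurable_snd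
  simp only [so2DerivCoeff, so2Coeff]
  fun_prop

/-- The Kac-Rice formula for the expected number of real zeros. -/
theorem lintegral_encard_zeros_so2Poly (hc_meas : ∀ k, Measurable (c k))
    (hc_indep : iIndepFun c P) (hr : Measurable r)
    (hc_law : P.map (c 0) = volume.withDensity (fun t => ENNReal.ofReal (r t)))
    (n : ℕ) (a b : ℝ) :
    ∫⁻ ω, (({x : ℝ | x ∈ Icc a b ∧ so2Poly (fun k => c k ω) n x = 0}.encard : ℕ∞) : ℝ≥0∞) ∂P
      = ∫⁻ x in Icc a b, so2KacRice P c r n x := by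
  classical
  -- The coefficients of positive index, extended by zero: a random sequence independent of `c 0`
  -- that determines the nonconstant part.
  set Y : Ω → ℕ → ℝ := fun ω k => if k ∈ posRange n then c k ω else 0 with hY
  have hYm : Measurable Y := by
    refine measurable_pi_lambda _ fun k => ?_
    simp only [hY]
    split_ifs
    · exact hc_meas k
    · exact measurable_const
  have hind : IndepFun (c 0) Y P := by
    have h := hc_indep.indepFun_finset {0} (posRange n) (by simp [posRange]) hc_meas
    have h1 : Measurable fun v : ({0} : Finset ℕ) → ℝ => v ⟨0, Finset.mem_singleton_self 0⟩ :=
      measurable_pi_apply _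
    have h2 : Measurable fun (v : posRange n → ℝ) (k : ℕ) =>
        if hk : k ∈ posRange n then v ⟨k, hk⟩ else 0 := by
      refine measurable_pi_lambda _ fun k => ?_
      by_cases hk : k ∈ posRange n
      · simp only [hk, dif_pos]
        exact measurable_pi_apply _
      · simp [hk]
    exact h.comp h1 h2
  set F : ℝ × (ℕ → ℝ) → ℝ → ℝ := fun p x => p.1 - (so2NegTail n p.2).eval x with hF
  have hFc : Continuous (Function.uncurry F) := by
    simp only [hF, Function.uncurry_def, eval_so2NegTail, so2Coeff]
    fun_prop
  set N : ℝ × (ℕ → ℝ) → ℝ≥0∞ := fun p => (({x : ℝ | x ∈ Icc a b ∧ F p x = 0}.encard : ℕ∞) : ℝ≥0∞)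
    with hN
  have hNm : Measurable N := measurable_encard_zeros hFc a b
  have hpoly : ∀ ω x, so2Poly (fun k => c k ω) n x = F (c 0 ω, Y ω) x := fun ω x => by
    rw [so2Poly_eq]
    simp only [hF]
    rw [so2NegTail_congr (y' := Y ω)]
    intro k hk
    simp [hY, hk]
  have hmap : P.map (fun ω => (c 0 ω, Y ω)) = (P.map (c 0)).prod (P.map Y) :=
    (indepFun_iff_map_prod_eq_prod_map_map (hc_meas 0).aemeasurable hYm.aemeasurable).1 hind
  have : IsProbabilityMeasure (P.map (c 0)) :=
    Measure.isProbabilityMeasure_map (hc_meas 0).aemeasurable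
  have : IsProbabilityMeasure (P.map Y) := Measure.isProbabilityMeasure_map hYm.aemeasurable
  have hinner : ∀ y : ℕ → ℝ, ∫⁻ t, N (t, y) ∂(P.map (c 0))
      = ∫⁻ x in Icc a b, ENNReal.ofReal (|∑ k ∈ posRange n, so2DerivCoeff n x k * y k|
          * r (-∑ k ∈ posRange n, so2Coeff n x k * y k)) := fun y => by
    have hNy : Measurable fun t => N (t, y) := hNm.comp (by fun_prop)
    rw [hc_law, lintegral_withDensity_eq_lintegral_mul _ (by fun_prop) hNy]
    have h1 := lintegral_encard_fiber_mul (so2NegTail n y) (measurableSet_Icc (a := a) (b := b))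
      (r := fun t => ENNReal.ofReal (r t)) (by fun_prop)
    convert! h1 using 1
    · refine lintegral_congr fun t => ?_
      rw [Pi.mul_apply, mul_comm]
      simp only [hN, hF, sub_eq_zero, eq_comm (a := t)]
    · refine lintegral_congr fun x => ?_
      rw [eval_so2NegTail, eval_derivative_so2NegTail, abs_neg, ENNReal.ofReal_mul (abs_nonneg _)]
  calc _ = ∫⁻ ω, N (c 0 ω, Y ω) ∂P := by simp only [hN, hpoly]
    _ = ∫⁻ p, N p ∂((P.map (c 0)).prod (P.map Y)) := by
        rw [← hmap, lintegral_map hNm ((hc_meas 0).prodMk hYm)]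
    _ = ∫⁻ y, ∫⁻ t, N (t, y) ∂(P.map (c 0)) ∂(P.map Y) :=
        lintegral_prod_symm _ hNm.aemeasurable
    _ = ∫⁻ x in Icc a b, ∫⁻ y, ENNReal.ofReal (|∑ k ∈ posRange n, so2DerivCoeff n x k * y k|
          * r (-∑ k ∈ posRange n, so2Coeff n x k * y k)) ∂(P.map Y) := by
        simp_rw [hinner]
        refine lintegral_lintegral_swap (Measurable.aemeasurable ?_)
        simp only [Function.uncurry_def, so2DerivCoeff, so2Coeff]
        fun_prop
    _ = _ := by
        refine lintegral_congr fun x => ?_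
        rw [lintegral_map (by fun_prop) hYm, so2KacRice]
        refine lintegral_congr fun ω => ?_
        have h1 : ∀ d : ℕ → ℝ, ∑ k ∈ posRange n, d k * Y ω k = ∑ k ∈ posRange n, d k * c k ω :=
          fun d => Finset.sum_congr rfl fun k hk => by simp [hY, hk]
        rw [h1, h1]

/-- Passing to real values loses nothing: `c 0` is almost surely nonzero, so the expected count is
at most `n` and the density is finite almost everywhere. -/
theorem isRealZeroDensity_so2KacRice (hc_meas : ∀ k, Measurable (c k))
    (hc_indep : iIndepFun c P) (hr : Measurable r)
    (hc_law : P.map (c 0) = volume.withDensity (fun t => ENNReal.ofReal (r t))) (n : ℕ) :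
    IsRealZeroDensity P (fun ω => so2Poly (fun k => c k ω) n)
      fun x => (so2KacRice P c r n x).toReal where
  measurable := (measurable_so2KacRice hc_meas hr n).ennreal_toReal
  nonneg _ := ENNReal.toReal_nonneg
  expected_card a b _ := by
    have h := lintegral_encard_zeros_so2Poly hc_meas hc_indep hr hc_law n a b
    have hc0 : ∀ᵐ ω ∂P, c 0 ω ≠ 0 := by
      have h1 : P.map (c 0) {0} = 0 := by
        rw [hc_law]
        exact withDensity_absolutelyContinuous _ _ (by simp)
      rw [Measure.map_apply (hc_meas 0) (measurableSet_singleton 0)] at h1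
      exact compl_mem_ae_iff.2 h1
    have hfin : ∫⁻ x in Icc a b, so2KacRice P c r n x ≠ ∞ := by
      rw [← h]
      refine ne_top_of_le_ne_top (b := ∫⁻ _, (n : ℝ≥0∞) ∂P) (by simp) (lintegral_mono_ae ?_)
      filter_upwards [hc0] with ω hω
      have := ENat.toENNReal_mono (encard_zeros_so2Poly_le (fun k => c k ω) n hω a b)
      simpa using this
    rw [h]
    refine lintegral_congr_ae ?_
    filter_upwards [ae_lt_top (measurable_so2KacRice hc_meas hr n) hfin] with x hx
    rw [ENNReal.ofReal_toReal hx.ne]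

end

/-! ### Decorrelation of `f_n(x)` and `f_n'(x)` -/

theorem continuous_uncurry_linCharFun {φ : ℝ → ℂ} (hφ : Continuous φ) (I : Finset ℕ)
    (a b : ℕ → ℝ) : Continuous (Function.uncurry (linCharFun φ I a b)) := by
  simp only [linCharFun, Function.uncurry_def]
  fun_prop

theorem absDensityIntegral_eq {Φ : ℝ → ℝ → ℂ}
    (hI : Integrable fun p : ℝ × ℝ => secondDiff Φ p.1 p.2 / (p.2 : ℂ) ^ 2)
    (hs : ∀ t, Integrable fun s => Φ s t) :
    absDensityIntegral Φ
      = ∫ t : ℝ, ((∫ s, Φ s 0) - ((∫ s, Φ s t) + ∫ s, Φ s (-t)) / 2) / (t : ℂ) ^ 2 := by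
  rw [absDensityIntegral]
  rw [Measure.volume_eq_prod] at hI ⊢
  rw [integral_prod_symm _ hI]
  refine integral_congr_ae (ae_of_all _ fun t => ?_)
  simp only [secondDiff]
  have h2 := integral_sub (hs 0) (((hs t).add (hs (-t))).div_const 2)
  simp only [Pi.add_apply] at h2
  rw [integral_div, h2, integral_div, integral_add (hs t) (hs (-t))]

/-- The shear `s + κ * t` does not respect second differences pointwise, but it disappears by
translation once the integral over `s` is done first. Scaling then gives `1 / σ` from `s`, and `τ ^
2` from the kernel times `1 / τ` from `t`. -/
theorem absDensityIntegral_comp_linear {Φ : ℝ → ℝ → ℂ} {σ τ : ℝ} (κ : ℝ) (hσ : 0 < σ) (hτ : 0 < τ)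
    (hI : Integrable fun p : ℝ × ℝ => secondDiff Φ p.1 p.2 / (p.2 : ℂ) ^ 2)
    (hs : ∀ t, Integrable fun s => Φ s t)
    (hI' : Integrable fun p : ℝ × ℝ =>
      secondDiff (fun s t => Φ (σ * (s + κ * t)) (τ * t)) p.1 p.2 / (p.2 : ℂ) ^ 2) :
    absDensityIntegral (fun s t => Φ (σ * (s + κ * t)) (τ * t))
      = (τ / σ : ℝ) * absDensityIntegral Φ := by
  have hs' : ∀ t, Integrable fun s => Φ (σ * (s + κ * t)) (τ * t) := fun t =>
    ((hs (τ * t)).comp_mul_left' hσ.ne').comp_add_right (κ * t)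
  have hA : ∀ t, ∫ s, Φ (σ * (s + κ * t)) (τ * t) = (σ : ℂ)⁻¹ * ∫ s, Φ s (τ * t) := fun t => by
    rw [integral_add_right_eq_self (fun s => Φ (σ * s) (τ * t)) (κ * t),
      Measure.integral_comp_mul_left (fun s => Φ s (τ * t)), abs_of_pos (inv_pos.2 hσ),
      Complex.real_smul, Complex.ofReal_inv]
  rw [absDensityIntegral_eq hI' hs', absDensityIntegral_eq hI hs]
  set g : ℝ → ℂ := fun t => ((∫ s, Φ s 0) - ((∫ s, Φ s t) + ∫ s, Φ s (-t)) / 2) / (t : ℂ) ^ 2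
    with hg
  have hpt : ∀ t : ℝ, ((∫ s, Φ (σ * (s + κ * 0)) (τ * 0)) - ((∫ s, Φ (σ * (s + κ * t)) (τ * t))
      + ∫ s, Φ (σ * (s + κ * -t)) (τ * -t)) / 2) / (t : ℂ) ^ 2
      = (σ : ℂ)⁻¹ * (τ : ℂ) ^ 2 * g (τ * t) := fun t => by
    rw [hA, hA, hA]
    simp only [hg, mul_zero, mul_neg, Complex.ofReal_mul]
    rcases eq_or_ne t 0 with rfl | ht
    · simp
    have h1 : (t : ℂ) ≠ 0 := by exact_mod_cast ht
    have h2 : (τ : ℂ) ≠ 0 := by exact_mod_cast hτ.ne'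
    field_simp
  simp_rw [hpt]
  rw [integral_const_mul, Measure.integral_comp_mul_left g, abs_of_pos (inv_pos.2 hτ),
    Complex.real_smul]
  have h2 : (τ : ℂ) ≠ 0 := by exact_mod_cast hτ.ne'
  have h3 : (σ : ℂ) ≠ 0 := by exact_mod_cast hσ.ne'
  push_cast
  field_simp

/-- The term `n * x / (1 + x ^ 2)` is the regression coefficient of `f_n'(x)` on `f_n(x)`. The
latter has variance `(1 + x ^ 2) ^ n`, and the residual has `n / (1 + x ^ 2) ^ 2` times that
variance. -/
theorem so2Coeff_mul_add (n : ℕ) {x : ℝ} (hx : x ≠ 0) (hn : n ≠ 0) (k : ℕ) (s t : ℝ) :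
    so2Coeff n x k * s + so2DerivCoeff n x k * t
      = so2Weight n x k * (Real.sqrt ((1 + x ^ 2) ^ n) * (s + n * x / (1 + x ^ 2) * t)
        + Real.sqrt ((1 + x ^ 2) ^ n) * Real.sqrt n / (1 + x ^ 2) * t * so2Pos n x k) := by
  have h1 : 0 < 1 + x ^ 2 := by positivity
  have h2 : 0 < Real.sqrt ((1 + x ^ 2) ^ n) := Real.sqrt_pos.2 (by positivity)
  have hn' : 0 < (n : ℝ) := by exact_mod_cast Nat.pos_of_ne_zero hn
  have h3 : 0 < Real.sqrt n := Real.sqrt_pos.2 hn'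
  have h4 : (k : ℝ) * x ^ (k - 1) = k * x ^ k / x := by
    rcases k with _ | k
    · simp
    · rw [Nat.add_sub_cancel, pow_succ]; field_simp
  rw [so2Coeff, so2DerivCoeff, so2Weight, so2Pos, h4]
  field_simp
  ring

theorem linCharFun_so2 (φ : ℝ → ℂ) (I : Finset ℕ) (n : ℕ) {x : ℝ} (hx : x ≠ 0) (hn : n ≠ 0)
    (s t : ℝ) :
    linCharFun φ I (so2Coeff n x) (so2DerivCoeff n x) s t
      = linCharFun φ I (so2Weight n x) (fun k => so2Weight n x k * so2Pos n x k)
        (Real.sqrt ((1 + x ^ 2) ^ n) * (s + n * x / (1 + x ^ 2) * t))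
        (Real.sqrt ((1 + x ^ 2) ^ n) * Real.sqrt n / (1 + x ^ 2) * t) := by
  refine Finset.prod_congr rfl fun k _ => ?_
  rw [so2Coeff_mul_add n hx hn]
  congr 1
  ring

/-- Uniform polynomial decay of the characteristic functions of standardized pairs of linear forms,
even if up to three factors are removed. -/
def HasUniformDecay (φ : ℝ → ℂ) (M₀ D : ℝ) : Prop :=
  ∀ (I : Finset ℕ) (w z : ℕ → ℝ) (M : ℝ), M₀ ≤ M → IsStdWeights I w z M →
    ∀ R : Finset ℕ, R.card ≤ 3 → ∀ s t : ℝ,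
      ∏ k ∈ I \ R, ‖φ (w k * (s + t * z k))‖ ≤ D / (1 + s ^ 2 + t ^ 2) ^ 6

/-- Parseval is applied without the constant coefficient, so integrability is needed for the product
over positive indices. Deleting index `0` on top of the two factors lost to differentiation accounts
for the three allowed deletions. The constants here may depend on `n` and `x`. -/
theorem integrable_secondDiff_so2_posRange {φ φ₁ φ₂ : ℝ → ℂ} {c₂ c₃ M₀ D δ : ℝ}
    (hφ : IsSmoothCharFun φ φ₁ φ₂ c₂ c₃) (hD : 0 < D) (hdec : HasUniformDecay φ M₀ D)
    {n : ℕ} {x : ℝ} (hδ : 0 < δ) (hx : x ∈ awayFromZero δ) (hn : 4 / δ ^ 2 ≤ n)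
    (hM : M₀ ≤ Real.sqrt n * δ / 2) :
    Integrable fun p : ℝ × ℝ => secondDiff (linCharFun φ (posRange n) (so2Coeff n x)
      (so2DerivCoeff n x)) p.1 p.2 / (p.2 : ℂ) ^ 2 := by
  have hn0 : 0 < (n : ℝ) := lt_of_lt_of_le (by positivity) hn
  have hn1 : n ≠ 0 := by rintro rfl; simp at hn0
  have hxne : x ≠ 0 := abs_pos.1 (lt_of_lt_of_le hδ hx.1)
  have hw := isStdWeights_so2 hδ hx hn
  have h1x : 0 < 1 + x ^ 2 := by positivity
  set σ := Real.sqrt ((1 + x ^ 2) ^ n) with hσ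
  have hσ0 : 0 < σ := Real.sqrt_pos.2 (by positivity)
  set κ := n * x / (1 + x ^ 2) with hκ
  set τ := σ * Real.sqrt n / (1 + x ^ 2) with hτ
  have hτ0 : 0 < τ := by
    have := Real.sqrt_pos.2 hn0
    positivity
  -- `L` bounds the distortion of `1 + s ^ 2 + t ^ 2` under the inverse of the normalizing change of
  -- variables.
  set L := 1 + 2 / σ ^ 2 + (2 * κ ^ 2 + 1) / τ ^ 2 with hL
  have hL1 : 1 ≤ L := by
    have : 0 ≤ 2 / σ ^ 2 + (2 * κ ^ 2 + 1) / τ ^ 2 := by positivity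
    linarith
  have hlin : ∀ s t : ℝ, 1 + s ^ 2 + t ^ 2
      ≤ L * (1 + (σ * (s + κ * t)) ^ 2 + (τ * t) ^ 2) := fun s t => by
    have e1 : s ^ 2 ≤ 2 / σ ^ 2 * (σ * (s + κ * t)) ^ 2 + 2 * κ ^ 2 / τ ^ 2 * (τ * t) ^ 2 := by
      have : 2 / σ ^ 2 * (σ * (s + κ * t)) ^ 2 + 2 * κ ^ 2 / τ ^ 2 * (τ * t) ^ 2
          = 2 * (s + κ * t) ^ 2 + 2 * κ ^ 2 * t ^ 2 := by field_simp
      rw [this]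
      nlinarith [sq_nonneg (s + 2 * (κ * t))]
    have e2 : t ^ 2 = 1 / τ ^ 2 * (τ * t) ^ 2 := by field_simp
    have e3 : (2 * κ ^ 2 + 1) / τ ^ 2 = 2 * κ ^ 2 / τ ^ 2 + 1 / τ ^ 2 := by ring
    set X := (σ * (s + κ * t)) ^ 2
    set Y := (τ * t) ^ 2
    have hX : 0 ≤ X := sq_nonneg _
    have hY : 0 ≤ Y := sq_nonneg _
    have f1 : 0 ≤ 2 / σ ^ 2 := by positivity
    have f2 : 0 ≤ 2 * κ ^ 2 / τ ^ 2 := by positivity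
    have f3 : 0 ≤ 1 / τ ^ 2 := by positivity
    rw [hL, e3]
    nlinarith [mul_nonneg f1 hY, mul_nonneg f2 hX, mul_nonneg f3 hX]
  have hDec : ∀ R ⊆ posRange n, R.card ≤ 2 → ∀ s t : ℝ,
      ∏ k ∈ posRange n \ R, ‖φ (so2Coeff n x k * s + so2DerivCoeff n x k * t)‖
        ≤ D * L ^ 2 / (1 + s ^ 2 + t ^ 2) ^ 2 := fun R _ hR s t => by
    have hset : posRange n \ R = Finset.range (n + 1) \ insert 0 R := by
      ext k; simp [posRange]; tauto
    have h1 := hdec _ _ _ _ hM hw (insert 0 R)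
      ((Finset.card_insert_le _ _).trans (by omega)) (σ * (s + κ * t)) (τ * t)
    rw [hset]
    simp_rw [so2Coeff_mul_add n hxne hn1]
    refine h1.trans ?_
    set V := 1 + (σ * (s + κ * t)) ^ 2 + (τ * t) ^ 2 with hV
    have hV1 : 1 ≤ V := by
      have : 0 ≤ (σ * (s + κ * t)) ^ 2 + (τ * t) ^ 2 := by positivity
      linarith
    calc D / V ^ 6 ≤ D / V ^ 2 := by
          gcongr
          norm_num
      _ = D * L ^ 2 / (L * V) ^ 2 := by field_simp
      _ ≤ D * L ^ 2 / (1 + s ^ 2 + t ^ 2) ^ 2 := by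
          gcongr
          exact hlin s t
  set A := ∑ k ∈ posRange n, (so2Coeff n x k ^ 2 + so2DerivCoeff n x k ^ 2) with hA
  have hA0 : 0 ≤ A := Finset.sum_nonneg fun k _ => by positivity
  have hc₂ := hφ.const₂_nonneg
  set C := D * L ^ 2 * (c₂ * A + 2 * c₂ ^ 2 * A ^ 2) with hC
  have hC0 : 0 ≤ C := by positivity
  refine integrable_secondDiff_div_sq (continuous_uncurry_linCharFun hφ.continuous _ _ _)
    (C := C + D * L ^ 2) (fun s t => ?_) (fun s t => ?_)
  · refine (norm_secondDiff_linCharFun_le hφ _ _ _ le_rfl hDec s t).trans ?_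
    gcongr
    have : 0 ≤ D * L ^ 2 := by positivity
    linarith
  · have h1 := hDec ∅ (by simp) (by simp) s t
    rw [Finset.sdiff_empty] at h1
    rw [linCharFun, norm_prod]
    refine h1.trans (div_le_div₀ (by positivity) (by linarith) (by positivity) ?_)
    nlinarith [sq_nonneg s, sq_nonneg t, sq_nonneg (s * t), sq_nonneg (s ^ 2)]

/-! ### The normalized density: limit, continuity, exact formula -/

/-- The characteristic function of `(f_n(x), f_n'(x))`, decorrelated and normalized. -/
noncomputable def so2CharFun (φ : ℝ → ℂ) (n : ℕ) (x : ℝ) : ℝ → ℝ → ℂ :=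
  linCharFun φ (Finset.range (n + 1)) (so2Weight n x) fun k => so2Weight n x k * so2Pos n x k

/-- The Fourier expression for the normalized density of zeros. -/
noncomputable def so2Density (φ : ℝ → ℂ) (n : ℕ) (x : ℝ) : ℝ :=
  ((2 * Real.pi * cosKernelConst : ℝ)⁻¹ * absDensityIntegral (so2CharFun φ n x)).re

/-- Bounds, with constant `C`, for the normalized characteristic functions that hold from
`4 / δ ^ 2 ≤ n` and `M₀ ≤ √n * δ / 2` on. -/
def HasSo2Bounds (φ : ℝ → ℂ) (M₀ C : ℝ) : Prop :=
  ∀ (δ : ℝ) (n : ℕ) (x lam : ℝ), 0 < δ → x ∈ awayFromZero δ → 4 / δ ^ 2 ≤ n →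
    M₀ ≤ Real.sqrt n * δ / 2 → 0 < lam → lam ^ 6 = 1 / (Real.sqrt n * δ / 2) → ∀ s t : ℝ,
      ‖secondDiff (so2CharFun φ n x) s t‖ ≤ C / (1 + s ^ 2) * t ^ 2 ∧
      ‖so2CharFun φ n x s t‖ ≤ C / (1 + s ^ 2) ∧
      ‖secondDiff (so2CharFun φ n x) s t - secondDiff gaussCharFun s t‖
        ≤ C / (1 + s ^ 2) * min (t ^ 2) (lam ^ 2)

theorem exists_hasSo2Bounds {φ φ₁ φ₂ : ℝ → ℂ} {c₂ c₃ M₀ D : ℝ}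
    (hφ : IsSmoothCharFun φ φ₁ φ₂ c₂ c₃) (hD : 0 < D) (hM₀ : 1 ≤ M₀)
    (hdec : HasUniformDecay φ M₀ D) : ∃ C : ℝ, 0 < C ∧ HasSo2Bounds φ M₀ C := by
  obtain ⟨C, hC, h⟩ := exists_secondDiff_sub_gauss_le hφ hD
  refine ⟨C, hC, fun δ n x lam hδ hx hn hM hlam hlam6 s t => ?_⟩
  have hw := isStdWeights_so2 hδ hx hn
  refine h _ _ _ _ lam (by linarith) hlam hlam6 hw (fun R hR s t => ?_) s t
  have := hdec _ _ _ _ hM hw R (by omega) s t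
  convert this using 4
  ring

theorem exists_pow_six_eq {y : ℝ} (hy : 0 < y) : ∃ lam : ℝ, 0 < lam ∧ lam ^ 6 = y :=
  ⟨y ^ (1 / 6 : ℝ), Real.rpow_pos_of_pos hy _, by
    rw [← Real.rpow_natCast, ← Real.rpow_mul hy.le]; norm_num⟩

section bounds

variable {φ : ℝ → ℂ} {M₀ C δ : ℝ} {n : ℕ}

theorem integrable_secondDiff_so2CharFun (hφ : Continuous φ) (hb : HasSo2Bounds φ M₀ C)
    (hM₀ : 1 ≤ M₀) (hδ : 0 < δ) {x : ℝ} (hx : x ∈ awayFromZero δ) (hn : 4 / δ ^ 2 ≤ n)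
    (hM : M₀ ≤ Real.sqrt n * δ / 2) :
    Integrable fun p : ℝ × ℝ => secondDiff (so2CharFun φ n x) p.1 p.2 / (p.2 : ℂ) ^ 2 := by
  obtain ⟨lam, hlam, hlam6⟩ := exists_pow_six_eq (y := 1 / (Real.sqrt n * δ / 2))
    (one_div_pos.2 (by linarith))
  have h := hb δ n x lam hδ hx hn hM hlam hlam6
  exact integrable_secondDiff_div_sq (continuous_uncurry_linCharFun hφ _ _ _)
    (fun s t => (h s t).1) fun s t => (h s t).2.1

theorem abs_so2Density_sub_le (hφ : Continuous φ) (hb : HasSo2Bounds φ M₀ C)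
    (hM₀ : 1 ≤ M₀) (hδ : 0 < δ) {x : ℝ} (hx : x ∈ awayFromZero δ) (hn : 4 / δ ^ 2 ≤ n)
    (hM : M₀ ≤ Real.sqrt n * δ / 2) {lam : ℝ} (hlam : 0 < lam)
    (hlam6 : lam ^ 6 = 1 / (Real.sqrt n * δ / 2)) :
    |so2Density φ n x - 1 / Real.pi| ≤ C * Real.pi / cosKernelConst * lam := by
  have h := hb δ n x lam hδ hx hn hM hlam hlam6
  have hc := cosKernelConst_pos
  have hpi := Real.pi_pos
  have hG : Integrable fun p : ℝ × ℝ => secondDiff gaussCharFun p.1 p.2 / (p.2 : ℂ) ^ 2 := by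
    refine integrable_secondDiff_div_sq (C := 92160) ?_ (fun s t => ?_) (fun s t => ?_)
    · simp only [gaussCharFun, Function.uncurry_def]
      fun_prop
    · refine (norm_secondDiff_gaussCharFun_le s t).trans ?_
      gcongr
      norm_num
    · refine (norm_gaussCharFun_le s t).trans
        (div_le_div_of_nonneg_left (by norm_num) (by positivity) ?_)
      calc 1 + s ^ 2 ≤ 1 + s ^ 2 + t ^ 2 := by nlinarith [sq_nonneg t]
        _ ≤ (1 + s ^ 2 + t ^ 2) ^ 6 :=
          le_self_pow₀ (by nlinarith [sq_nonneg s, sq_nonneg t]) (by norm_num)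
  have hdiff := norm_absDensityIntegral_sub_le hlam
    (integrable_secondDiff_so2CharFun hφ hb hM₀ hδ hx hn hM) hG fun s t => (h s t).2.2
  set K : ℝ := 2 * Real.pi * cosKernelConst with hK
  have hK0 : 0 < K := by positivity
  have hGv : 1 / Real.pi = ((K : ℂ)⁻¹ * absDensityIntegral gaussCharFun).re := by
    rw [absDensityIntegral_gaussCharFun, ← Complex.ofReal_inv, ← Complex.ofReal_mul,
      Complex.ofReal_re, hK]
    field_simp
  rw [so2Density, hGv, ← hK, Complex.ofReal_inv, ← Complex.sub_re, ← mul_sub]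
  refine (Complex.abs_re_le_norm _).trans ?_
  rw [norm_mul, norm_inv, Complex.norm_real, Real.norm_of_nonneg hK0.le]
  calc K⁻¹ * ‖absDensityIntegral (so2CharFun φ n x) - absDensityIntegral gaussCharFun‖
      ≤ K⁻¹ * (2 * C * Real.pi ^ 2 * lam) := by gcongr
    _ = _ := by rw [hK]; field_simp

theorem continuousOn_so2Density (hφ : Continuous φ) (hb : HasSo2Bounds φ M₀ C)
    (hM₀ : 1 ≤ M₀) (hδ : 0 < δ) (hn : 4 / δ ^ 2 ≤ n) (hM : M₀ ≤ Real.sqrt n * δ / 2) :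
    ContinuousOn (so2Density φ n) (awayFromZero δ) := by
  obtain ⟨lam, hlam, hlam6⟩ := exists_pow_six_eq (y := 1 / (Real.sqrt n * δ / 2))
    (one_div_pos.2 (by linarith))
  have hn0 : 0 < (n : ℝ) := lt_of_lt_of_le (by positivity) hn
  have hw : ∀ k, ContinuousOn (fun x => so2Weight n x k) (awayFromZero δ) := fun k => by
    have : Continuous fun x => so2Weight n x k := by
      refine Continuous.div (by fun_prop) (by fun_prop) fun x => ?_
      exact (Real.sqrt_pos.2 (by positivity)).ne'
    exact this.continuousOn
  have hz : ∀ k, ContinuousOn (fun x => so2Pos n x k) (awayFromZero δ) := fun k => by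
    refine ContinuousOn.div (by fun_prop) (by fun_prop) fun x hx => ?_
    exact mul_ne_zero (Real.sqrt_pos.2 hn0).ne' (abs_pos.1 (lt_of_lt_of_le hδ hx.1))
  have hΦ : ∀ s t : ℝ, ContinuousOn (fun x => so2CharFun φ n x s t) (awayFromZero δ) :=
    fun s t => by
      have h : ∀ k, ContinuousOn
          (fun x => so2Weight n x k * s + so2Weight n x k * so2Pos n x k * t) (awayFromZero δ) :=
        fun k => ((hw k).mul continuousOn_const).add (((hw k).mul (hz k)).mul continuousOn_const)
      simp only [so2CharFun, linCharFun]
      exact continuousOn_finsetProd _ fun k _ => hφ.comp_continuousOn (h k)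
  refine Complex.continuous_re.comp_continuousOn (continuousOn_const.mul ?_)
  refine continuousOn_of_dominated
    (bound := fun p : ℝ × ℝ => 4 * C * ((1 + p.1 ^ 2)⁻¹ * (1 + p.2 ^ 2)⁻¹))
    (fun x hx => (integrable_secondDiff_so2CharFun hφ hb hM₀ hδ hx hn hM).aestronglyMeasurable)
    (fun x hx => ae_of_all _ fun p => ?_) (integrable_inv_one_add_sq_mul.const_mul _)
    (ae_of_all _ fun p => ?_)
  · have h := hb δ n x lam hδ hx hn hM hlam hlam6
    exact norm_secondDiff_div_sq_le (fun s t => (h s t).1) (fun s t => (h s t).2.1) _ _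
  · exact ((hΦ p.1 0).sub (((hΦ p.1 p.2).add (hΦ p.1 (-p.2))).div_const 2)).div_const _

/-- The exact formula for the density of zeros away from `0`, for large `n`. -/
theorem toReal_so2KacRice_eq {Ω : Type*} [MeasurableSpace Ω] {P : Measure Ω}
    [IsProbabilityMeasure P] {c : ℕ → Ω → ℝ} (hc_meas : ∀ k, Measurable (c k))
    (hc_indep : iIndepFun c P) (hφP : ∀ k, φ = charFun (P.map (c k)))
    (hc_int : ∀ k, Integrable (c k) P) {r : ℝ → ℝ} (hr : Continuous r) (hr0 : ∀ t, 0 ≤ r t)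
    (hri : Integrable r) (hφr : φ = charFun (volume.withDensity fun t => ENNReal.ofReal (r t)))
    {φ₁ φ₂ : ℝ → ℂ} {c₂ c₃ D : ℝ} (hφ : IsSmoothCharFun φ φ₁ φ₂ c₂ c₃) (hD : 0 < D)
    (hdec : HasUniformDecay φ M₀ D) (hb : HasSo2Bounds φ M₀ C) (hM₀ : 1 ≤ M₀) (hδ : 0 < δ)
    {x : ℝ} (hx : x ∈ awayFromZero δ) (hn : 4 / δ ^ 2 ≤ n) (hM : M₀ ≤ Real.sqrt n * δ / 2) :
    (so2KacRice P c r n x).toReal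
      = Real.sqrt n / (1 + x ^ 2) * max (so2Density φ n x) 0 := by
  have hn0 : 0 < (n : ℝ) := lt_of_lt_of_le (by positivity) hn
  have hn1 : n ≠ 0 := by rintro rfl; simp at hn0
  have hxne : x ≠ 0 := abs_pos.1 (lt_of_lt_of_le hδ hx.1)
  have h1x : 0 < 1 + x ^ 2 := by positivity
  have hsn := Real.sqrt_pos.2 hn0
  have hI := integrable_secondDiff_so2_posRange hφ hD hdec hδ hx hn hM
  set σ := Real.sqrt ((1 + x ^ 2) ^ n) with hσ
  have hσ0 : 0 < σ := Real.sqrt_pos.2 (by positivity)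
  set κ := n * x / (1 + x ^ 2) with hκ
  set τ := σ * Real.sqrt n / (1 + x ^ 2) with hτ
  have hτ0 : 0 < τ := by positivity
  -- The constant coefficient enters `f_n(x)` with factor `1` and `f_n'(x)` with factor `0`, so
  -- multiplying by `φ s` restores the full product.
  have hfull : (fun s t => φ s * linCharFun φ (posRange n) (so2Coeff n x) (so2DerivCoeff n x) s t)
      = fun s t => so2CharFun φ n x (σ * (s + κ * t)) (τ * t) := by
    ext s t
    rw [so2CharFun, ← linCharFun_so2 φ _ n hxne hn1, linCharFun, linCharFun, posRange,
      ← Finset.mul_prod_erase _ _ (Finset.mem_range.2 n.succ_pos)]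
    congr 2
    simp [so2Coeff, so2DerivCoeff]
  have hI' : Integrable fun p : ℝ × ℝ =>
      secondDiff (fun s t => so2CharFun φ n x (σ * (s + κ * t)) (τ * t)) p.1 p.2
        / (p.2 : ℂ) ^ 2 := by
    rw [← hfull]
    have h1 := hI.bdd_mul (c := 1) (f := fun p : ℝ × ℝ => φ p.1) (by
      have : Continuous fun p : ℝ × ℝ => φ p.1 := hφ.continuous.comp continuous_fst
      exact this.aestronglyMeasurable) (ae_of_all _ fun p => hφ.norm_le _)
    convert! h1 using 2 with p
    simp only [secondDiff]
    ring
  obtain ⟨lam, hlam, hlam6⟩ := exists_pow_six_eq (y := 1 / (Real.sqrt n * δ / 2))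
    (one_div_pos.2 (by linarith))
  have hbs := hb δ n x lam hδ hx hn hM hlam hlam6
  have hs : ∀ t, Integrable fun s => so2CharFun φ n x s t := fun t => by
    have hc : Continuous fun s => so2CharFun φ n x s t :=
      (continuous_uncurry_linCharFun hφ.continuous _ _ _).comp
        (by fun_prop : Continuous fun s : ℝ => (s, t))
    refine (integrable_inv_one_add_sq.const_mul C).mono' hc.aestronglyMeasurable
      (ae_of_all _ fun s => ?_)
    rw [← div_eq_mul_inv]
    exact (hbs s t).2.1
  -- The maximum with `0` in the result comes from `ENNReal.ofReal` and spares a proof that the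
  -- Fourier expression is nonnegative.
  rw [so2KacRice, lintegral_abs_mul_density_eq hc_meas hc_indep hφP hc_int hr hr0 hri hφr
    hφ.continuous hφ.norm_le _ _ _ hI, hfull, absDensityIntegral_comp_linear κ hσ0 hτ0
    (integrable_secondDiff_so2CharFun hφ.continuous hb hM₀ hδ hx hn hM) hs hI',
    ENNReal.toReal_ofReal', mul_left_comm, Complex.re_ofReal_mul, ← so2Density]
  have hratio : τ / σ = Real.sqrt n / (1 + x ^ 2) := by
    rw [hτ]; field_simp
  rw [hratio, mul_max_of_nonneg _ _ (by positivity), mul_zero]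

end bounds

/-! ### Proof of the theorem -/

/-- Mean `0` and variance `1` give `φ'(0) = 0` and `φ''(0) = -1`. The bound on the third derivative
then controls `φ'' + 1` linearly. -/
theorem isSmoothCharFun_of_law {ν : Measure ℝ} [IsProbabilityMeasure ν]
    (hν : MemLp id 2 ν) (hmean : ∫ t, t ∂ν = 0) (hvar : ∫ t, t ^ 2 ∂ν = 1) {φ : ℝ → ℂ}
    (hφ : φ = charFun ν) (hφ_diff : ∀ j : ℕ, j < 3 → Differentiable ℝ (iteratedDeriv j φ))
    {c₂ c₃ : ℝ} (hφ_two : ∀ s : ℝ, ‖iteratedDeriv 2 φ s‖ ≤ c₂)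
    (hφ_three : ∀ s : ℝ, ‖iteratedDeriv 3 φ s‖ ≤ c₃) :
    IsSmoothCharFun φ (iteratedDeriv 1 φ) (iteratedDeriv 2 φ) c₂ c₃ := by
  have hd : ∀ j < 3, ∀ u, HasDerivAt (iteratedDeriv j φ) (iteratedDeriv (j + 1) φ u) u :=
    fun j hj u => by
    rw [iteratedDeriv_succ]
    exact ((hφ_diff j hj) u).hasDerivAt
  have h1 : iteratedDeriv 1 φ 0 = 0 := by
    rw [hφ, iteratedDeriv_charFun_zero (n := 1) (by simpa using hν.mono_exponent (by norm_num))]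
    simp [hmean]
  have h2 : iteratedDeriv 2 φ 0 = -1 := by
    rw [hφ, iteratedDeriv_charFun_zero (n := 2) (by simpa using hν), hvar]
    simp
  refine ⟨?_, ?_, ?_, hd 1 (by norm_num), h1, hφ_two, fun u => ?_⟩
  · rw [hφ, charFun_zero]
    simp
  · rw [hφ]
    exact fun u => norm_charFun_le_one u
  · simpa using hd 0 (by norm_num)
  · exact norm_le_mul_abs_of_hasDerivAt (f := fun u => iteratedDeriv 2 φ u + 1)
      (B := fun _ => c₃) (fun u => (hd 2 (by norm_num) u).add_const 1) (by simp [h2])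
      (fun u _ _ => hφ_three u) u

theorem theorem3p1 {Ω : Type*} [MeasurableSpace Ω] (P : Measure Ω) [IsProbabilityMeasure P]
    -- the coefficients: independent, with common continuous density `r`, mean 0 and variance 1
    (c : ℕ → Ω → ℝ) (r : ℝ → ℝ)
    (hc_meas : ∀ k, Measurable (c k))
    (hc_indep : iIndepFun c P)
    (hr_cont : Continuous r) (hr_nonneg : ∀ t, 0 ≤ r t)
    (hc_law : ∀ k, P.map (c k) = volume.withDensity (fun t => ENNReal.ofReal (r t)))
    (hc_mean : ∀ k, ∫ ω, c k ω ∂P = 0)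
    (hc_var : ∀ k, ∫ ω, (c k ω) ^ 2 ∂P = 1)
    -- the common characteristic function `φ` and the two conditions on it
    (φ : ℝ → ℂ) (hφ : ∀ k, φ = charFun (P.map (c k)))
    (a q : ℝ) (ha : 0 < a) (hq : 0 < q)
    (hφ_decay : ∀ s : ℝ, ‖φ s‖ ≤ 1 / (1 + a * s ^ 2) ^ q)
    (hφ_diff : ∀ j : ℕ, j < 3 → Differentiable ℝ (iteratedDeriv j φ))
    (c₂ c₃ : ℝ)
    (hφ_two : ∀ s : ℝ, ‖iteratedDeriv 2 φ s‖ ≤ c₂)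
    (hφ_three : ∀ s : ℝ, ‖iteratedDeriv 3 φ s‖ ≤ c₃) :
    ∃ p : ℕ → ℝ → ℝ,
      (∀ n, IsRealZeroDensity P (fun ω => so2Poly (fun k => c k ω) n) (p n)) ∧
      ∀ δ : ℝ, 0 < δ →
        TendstoUniformlyOn (fun (n : ℕ) (x : ℝ) => p n x / Real.sqrt n)
          (fun x => 1 / (Real.pi * (1 + x ^ 2))) atTop (awayFromZero δ) ∧
        ∃ N : ℕ,
          -- continuity fixes the values of the density at every point
          (∀ n ≥ N, ContinuousOn (p n) (awayFromZero δ)) ∧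
          ∀ ε : ℝ, 0 < ε → ∃ C : ℝ, 0 < C ∧ ∀ n ≥ N, ∀ x ∈ awayFromZero δ,
            |p n x / Real.sqrt n - 1 / (Real.pi * (1 + x ^ 2))|
              ≤ C * (n : ℝ) ^ (-(1 / 12 : ℝ) + ε) := by

  have hmean' : ∀ f : ℝ → ℝ, Continuous f → ∫ t, f t ∂(P.map (c 0)) = ∫ ω, f (c 0 ω) ∂P :=
    fun f hf => integral_map (hc_meas 0).aemeasurable hf.aestronglyMeasurable
  have hprob : IsProbabilityMeasure (P.map (c 0)) :=
    Measure.isProbabilityMeasure_map (hc_meas 0).aemeasurable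
  have hsq : ∀ k, MemLp (c k) 2 P := fun k => by
    rw [memLp_two_iff_integrable_sq (hc_meas k).aestronglyMeasurable]
    by_contra h
    have := hc_var k
    rw [integral_undef h] at this
    exact zero_ne_one this
  have hc_int : ∀ k, Integrable (c k) P := fun k => (hsq k).integrable (by norm_num)
  have hsmooth : IsSmoothCharFun φ (iteratedDeriv 1 φ) (iteratedDeriv 2 φ) c₂ c₃ := by
    refine isSmoothCharFun_of_law (ν := P.map (c 0)) ?_ ?_ ?_ (hφ 0) hφ_diff hφ_two hφ_three
    · exact (memLp_map_measure_iff aestronglyMeasurable_id (hc_meas 0).aemeasurable).2 (hsq 0)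
    · exact (hmean' (fun t => t) continuous_id).trans (hc_mean 0)
    · exact (hmean' (fun t => t ^ 2) (by fun_prop)).trans (hc_var 0)
  have hφr : φ = charFun (volume.withDensity fun t => ENNReal.ofReal (r t)) := by
    rw [← hc_law 0]; exact hφ 0
  have hri : Integrable r := by
    refine ⟨hr_cont.aestronglyMeasurable, ?_⟩
    rw [hasFiniteIntegral_iff_ofReal (ae_of_all _ hr_nonneg), ← setLIntegral_univ,
      ← withDensity_apply _ MeasurableSet.univ, ← hc_law 0]
    exact measure_lt_top _ _
  obtain ⟨M₀, D, hM₀, hD, hdec⟩ := exists_prod_norm_le ha hq hφ_decay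
  obtain ⟨C, hC, hb⟩ := exists_hasSo2Bounds hsmooth hD hM₀ hdec
  have hφc := hsmooth.continuous
  refine ⟨fun n x => (so2KacRice P c r n x).toReal, fun n =>
    isRealZeroDensity_so2KacRice hc_meas hc_indep hr_cont.measurable (hc_law 0) n,
    fun δ hδ => ?_⟩
  -- The three terms ensure `n ≥ 1`, the fourth moment bound, and `M₀ ≤ √n * δ / 2`.
  obtain ⟨N, hN⟩ := exists_nat_ge (max 1 (max (4 / δ ^ 2) ((2 * M₀ / δ) ^ 2)))
  have hN1 : ∀ n ≥ N, (1 : ℝ) ≤ n := fun n hn =>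
    (le_max_left _ _).trans (hN.trans (by exact_mod_cast hn))
  have hNδ : ∀ n ≥ N, 4 / δ ^ 2 ≤ (n : ℝ) := fun n hn =>
    ((le_max_left _ _).trans (le_max_right _ _)).trans (hN.trans (by exact_mod_cast hn))
  have hNM : ∀ n ≥ N, M₀ ≤ Real.sqrt n * δ / 2 := fun n hn => by
    have h1 : (2 * M₀ / δ) ^ 2 ≤ n :=
      ((le_max_right _ _).trans (le_max_right _ _)).trans (hN.trans (by exact_mod_cast hn))
    have h2 := Real.le_sqrt_of_sq_le h1
    rw [div_le_iff₀ hδ] at h2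
    linarith
  have hformula : ∀ n ≥ N, ∀ x ∈ awayFromZero δ, (so2KacRice P c r n x).toReal
      = Real.sqrt n / (1 + x ^ 2) * max (so2Density φ n x) 0 := fun n hn x hx =>
    toReal_so2KacRice_eq hc_meas hc_indep hφ hc_int hr_cont hr_nonneg hri hφr hsmooth hD hdec hb
      hM₀ hδ hx (hNδ n hn) (hNM n hn)
  have hpi := Real.pi_pos
  have hc0 := cosKernelConst_pos
  set B := C * Real.pi / cosKernelConst * (2 / δ) ^ (1 / 6 : ℝ) with hB
  have hB0 : 0 < B := by positivity
  have hrate : ∀ n ≥ N, ∀ x ∈ awayFromZero δ,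
      |(so2KacRice P c r n x).toReal / Real.sqrt n - 1 / (Real.pi * (1 + x ^ 2))|
        ≤ B * (n : ℝ) ^ (-(1 / 12 : ℝ)) := fun n hn x hx => by
    have hn0 : 0 < (n : ℝ) := by linarith [hN1 n hn]
    have hsn := Real.sqrt_pos.2 hn0
    have h1x : 0 < 1 + x ^ 2 := by positivity
    -- The solution of `lam ^ 6 = 1 / (√n * δ / 2)`, the source of the exponent `1/12`.
    set lam := (2 / δ) ^ (1 / 6 : ℝ) * (n : ℝ) ^ (-(1 / 12 : ℝ)) with hlam
    have hlam0 : 0 < lam := by positivity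
    have hlam6 : lam ^ 6 = 1 / (Real.sqrt n * δ / 2) := by
      rw [hlam, mul_pow, ← Real.rpow_natCast, ← Real.rpow_natCast, ← Real.rpow_mul (by positivity),
        ← Real.rpow_mul hn0.le, Real.sqrt_eq_rpow]
      have e1 : (1 / 6 : ℝ) * ((6 : ℕ) : ℝ) = 1 := by norm_num
      have e2 : (-(1 / 12 : ℝ)) * ((6 : ℕ) : ℝ) = -(1 / 2 : ℝ) := by norm_num
      rw [e1, e2, Real.rpow_one, Real.rpow_neg hn0.le]
      field_simp
    have h := abs_so2Density_sub_le hφc hb hM₀ hδ hx (hNδ n hn) (hNM n hn) hlam0 hlam6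
    -- Truncation at `0` is 1-Lipschitz and fixes the positive limit `1 / π`.
    have hmax : |max (so2Density φ n x) 0 - 1 / Real.pi| ≤ |so2Density φ n x - 1 / Real.pi| := by
      have := abs_max_sub_max_le_abs (so2Density φ n x) (1 / Real.pi) 0
      rwa [max_eq_left (by positivity : 0 ≤ 1 / Real.pi)] at this
    rw [hformula n hn x hx]
    have e : Real.sqrt n / (1 + x ^ 2) * max (so2Density φ n x) 0 / Real.sqrt n
        - 1 / (Real.pi * (1 + x ^ 2))
        = (1 + x ^ 2)⁻¹ * (max (so2Density φ n x) 0 - 1 / Real.pi) := by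
      field_simp
    rw [e, abs_mul, abs_of_pos (inv_pos.2 h1x)]
    calc (1 + x ^ 2)⁻¹ * |max (so2Density φ n x) 0 - 1 / Real.pi|
        ≤ 1 * |max (so2Density φ n x) 0 - 1 / Real.pi| := by
          gcongr
          exact inv_le_one_of_one_le₀ (by nlinarith [sq_nonneg x])
      _ ≤ C * Real.pi / cosKernelConst * lam := by rw [one_mul]; exact hmax.trans h
      _ = _ := by rw [hB, hlam]; ring
  refine ⟨?_, N, fun n hn => ?_, fun ε hε => ⟨B, hB0, fun n hn x hx => ?_⟩⟩
  · rw [Metric.tendstoUniformlyOn_iff]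
    intro ε hε
    have hlim : Tendsto (fun n : ℕ => B * (n : ℝ) ^ (-(1 / 12 : ℝ))) atTop (nhds 0) := by
      have := ((tendsto_rpow_neg_atTop (y := 1 / 12) (by norm_num)).comp
        tendsto_natCast_atTop_atTop).const_mul B
      simpa using this
    filter_upwards [hlim.eventually_lt_const hε, eventually_ge_atTop N] with n hn1 hn2 x hx
    rw [dist_comm, Real.dist_eq]
    exact (hrate n hn2 x hx).trans_lt hn1
  · refine ContinuousOn.congr ?_ fun x hx => hformula n hn x hx
    refine ContinuousOn.mul (Continuous.continuousOn ?_)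
      ((continuousOn_so2Density hφc hb hM₀ hδ (hNδ n hn) (hNM n hn)).sup continuousOn_const)
    exact continuous_const.div (by fun_prop) fun x => by positivity
  -- The rate holds without `ε`, with a constant independent of it; the extra factor `n ^ ε` is at
  -- least `1` as `n ≥ 1`.
  · refine (hrate n hn x hx).trans ?_
    gcongr
    · exact hN1 n hn
    · linarith
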